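/- Let $f:\mathbb{R}^d\to\mathbb{R}$ be twice differentiable. Let $\sigma>0$, $L\in\mathbb{R}$, $\gamma\ge 0$, and assume that for all $x,y\in\mathbb{R}^d$ $$\|\nabla f(x)-\nabla f(y)\|\le L\|x-y\|,\qquad f(x)-f(y)\ge\langle\nabla f(y),x-y\rangle+\tfrac{\sigma}{2}\|x-y\|^2,\qquad \|\nabla^2f(x)-\nabla^2f(y)\|_2\le\gamma\|x-y\|,$$ that is, $f$ is $L$-smooth and $\sigma$-strongly convex and has a $\gamma$-Lipschitz Hessian. Here $\|\cdot\|$ is the Euclidean norm on vectors and $\|\cdot\|_2$ the spectral norm on matrices; $\|\cdot\|_F$ denotes the Frobenius norm. Let $0<\tau\le\zeta$ and $$\mathcal{S}=\{\Sigma\in\mathbb{R}^{d\times d}\text{ symmetric}:\ \zeta^{-1}I\preceq\Sigma\preceq\tau^{-1}I\}.$$ For a symmetric matrix $A$ let $\Pi_{\mathcal{S}}(A)=\operatorname{argmin}_{X\in\mathcal{S}}\|A-X\|_F$ be its Frobenius-norm projection onto $\mathcal{S}$. For $\alpha>0$, $\mu\in\mathbb{R}^d$ and $\Sigma\in\mathcal{S}$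 put $$Q_\alpha(\mu,\Sigma)=\mathbb{E}_{z\sim N(\mu,\alpha^2\Sigma)}[f(z)]-\frac{\alpha^2}{2}\log\det\Sigma .$$ Let $(\hat\mu_*,\hat\Sigma_*)$ be a minimizer of $Q_\alpha$ over $\mathbb{R}^d\times\mathcal{S}$, let $\mu_*$ be the minimizer of $f$, and let $\Sigma_*$ be a minimizer of $\Sigma\mapsto Q_\alpha(\mu_*,\Sigma)$ over $\mathcal{S}$. Write $$P_d=(d^3+6d^2+8d)^{5/6}+d\,(d^2+2d)^{3/4},$$ and assume that $$\alpha\,\gamma\,\zeta\,P_d\le 3\tau^{3/2}\sigma,$$ that is, $\alpha\le\frac{3\tau^{3/2}\sigma}{\gamma\zeta}P_d^{-1}$ when $\gamma>0$ and $d\ge1$ (there is no restriction on $\alpha$ when $\gamma=0$). Then $$\bigl\|\hat\Sigma_*-\Pi_{\mathcal{S}}\bigl((\nabla^2f(\hat\mu_*))^{-1}\bigr)\bigr\|_F\le\frac{\alpha\gamma\zeta}{3\tau^{3/2}\sigma^2}\,P_d$$ and $$\|\Sigma_*-\hat\Sigma_*\|_F\le\frac{2\alpha\gamma\zeta}{3\tau^{3/2}\sigma^2}\,P_d+\frac{\gamma}{\sigma^2}\left(\frac{2dL\alpha^2}{\sigma\tau}+\frac{2\gamma\alpha^3(d^2+2d)^{3/4}}{3\sigma\tau^{3/2}}+\frac{d\alpha^2}{\sigma}\bigl(\tau^{-1}-\zeta^{-1}\bigr)\right)^{1/2}.$$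 -/

import Mathlib

noncomputable section

namespace RegularizedES

open MeasureTheory ProbabilityTheory

/-- The Frobenius norm of a real square matrix. -/
def frobNorm {d : ℕ} (A : Matrix (Fin d) (Fin d) ℝ) : ℝ :=
  Real.sqrt (∑ i, ∑ j, A i j ^ 2)

/-- `f` is differentiable and its gradient is `L`-Lipschitz. -/
def IsLSmooth {d : ℕ} (L : ℝ) (f : EuclideanSpace ℝ (Fin d) → ℝ) : Prop :=
  Differentiable ℝ f ∧ ∀ x y, ‖gradient f x - gradient f y‖ ≤ L * ‖x - y‖

/-- `f` is differentiable and `σ`-strongly convex, in the first-order form. -/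
def IsStronglyConvex {d : ℕ} (σ : ℝ) (f : EuclideanSpace ℝ (Fin d) → ℝ) : Prop :=
  Differentiable ℝ f ∧
    ∀ x y, inner ℝ (gradient f y) (x - y) + σ / 2 * ‖x - y‖ ^ 2 ≤ f x - f y

/-- The Hessian matrix of `f` at `x`: the matrix, in the standard basis, of the derivative of the
gradient. -/
def hessian {d : ℕ} (f : EuclideanSpace ℝ (Fin d) → ℝ) (x : EuclideanSpace ℝ (Fin d)) :
    Matrix (Fin d) (Fin d) ℝ :=
  (Matrix.toEuclideanCLM (n := Fin d) (𝕜 := ℝ)).symm (fderiv ℝ (gradient f) x)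

/-- `f` is twice differentiable and its Hessian is `γ`-Lipschitz for the spectral norm (which is
the operator norm of the continuous linear map given by the matrix on Euclidean space). -/
def HasLipschitzHessian {d : ℕ} (γ : ℝ) (f : EuclideanSpace ℝ (Fin d) → ℝ) : Prop :=
  Differentiable ℝ f ∧ Differentiable ℝ (gradient f) ∧
    ∀ x y, ‖Matrix.toEuclideanCLM (n := Fin d) (𝕜 := ℝ) (hessian f x - hessian f y)‖
      ≤ γ * ‖x - y‖

/-- The Gaussian smoothing `J(μ, Σ)`: the expectation of `f z` for `z ∼ N(μ, α² Σ)`. -/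
def gaussJ {d : ℕ} (f : EuclideanSpace ℝ (Fin d) → ℝ) (α : ℝ)
    (μ : EuclideanSpace ℝ (Fin d)) (S : Matrix (Fin d) (Fin d) ℝ) : ℝ :=
  ∫ z, f z ∂(multivariateGaussian μ (α ^ 2 • S))

/-- The regularized objective `Q_α(μ, Σ) = J(μ, Σ) - (α² / 2) log det Σ`. -/
def regQ {d : ℕ} (f : EuclideanSpace ℝ (Fin d) → ℝ) (α : ℝ)
    (μ : EuclideanSpace ℝ (Fin d)) (S : Matrix (Fin d) (Fin d) ℝ) : ℝ :=
  gaussJ f α μ S - α ^ 2 / 2 * Real.log S.det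

/-- The constraint set of symmetric matrices `Σ` with `ζ⁻¹ I ⪯ Σ ⪯ τ⁻¹ I`. -/
def covSet (d : ℕ) (τ ζ : ℝ) : Set (Matrix (Fin d) (Fin d) ℝ) :=
  {S | (S - ζ⁻¹ • (1 : Matrix (Fin d) (Fin d) ℝ)).PosSemidef ∧
    (τ⁻¹ • (1 : Matrix (Fin d) (Fin d) ℝ) - S).PosSemidef}

/-- `P` is a nearest point of `𝒮` to `A` in the Frobenius norm. -/
def IsFrobProj {d : ℕ} (𝒮 : Set (Matrix (Fin d) (Fin d) ℝ))
    (A P : Matrix (Fin d) (Fin d) ℝ) : Prop :=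
  P ∈ 𝒮 ∧ ∀ X ∈ 𝒮, frobNorm (A - P) ≤ frobNorm (A - X)

lemma frobNorm_sq {d : ℕ} (A : Matrix (Fin d) (Fin d) ℝ) :
    frobNorm A ^ 2 = ∑ i, ∑ j, A i j ^ 2 :=
  Real.sq_sqrt (Finset.sum_nonneg fun _ _ => Finset.sum_nonneg fun _ _ => sq_nonneg _)

lemma posSemidef_real_iff {d : ℕ} (M : Matrix (Fin d) (Fin d) ℝ) :
    M.PosSemidef ↔ M.transpose = M ∧ ∀ x : Fin d → ℝ, 0 ≤ x ⬝ᵥ (M.mulVec x) := by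
  rw [Matrix.posSemidef_iff_dotProduct_mulVec]
  simp [Matrix.IsHermitian]

lemma isClosed_posSemidef_comp {d : ℕ}
    (g : Matrix (Fin d) (Fin d) ℝ → Matrix (Fin d) (Fin d) ℝ) (hg : Continuous g) :
    IsClosed {S | (g S).PosSemidef} := by
  simp only [posSemidef_real_iff, Set.ofPred_and, Set.ofPred_forall]
  refine IsClosed.inter (isClosed_eq (by fun_prop) hg) (isClosed_iInter fun x => ?_)
  exact isClosed_le continuous_const (by fun_prop)

lemma isClosed_covSet (d : ℕ) (τ ζ : ℝ) : IsClosed (covSet d τ ζ) :=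
  (isClosed_posSemidef_comp _ (by fun_prop)).inter (isClosed_posSemidef_comp _ (by fun_prop))

lemma covSet_nonempty (d : ℕ) {τ ζ : ℝ} (hτ : 0 < τ) (hτζ : τ ≤ ζ) : (covSet d τ ζ).Nonempty := by
  refine ⟨τ⁻¹ • 1, ?_, by simpa using Matrix.PosSemidef.zero⟩
  rw [← sub_smul]
  exact Matrix.PosSemidef.one.smul (sub_nonneg.2 (inv_anti₀ hτ hτζ))

lemma midpoint_mem_covSet {d : ℕ} {τ ζ : ℝ} {P Q : Matrix (Fin d) (Fin d) ℝ}
    (hP : P ∈ covSet d τ ζ) (hQ : Q ∈ covSet d τ ζ) : (1 / 2 : ℝ) • (P + Q) ∈ covSet d τ ζ := by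
  constructor
  · convert (hP.1.add hQ.1).smul (show (0 : ℝ) ≤ 1 / 2 by norm_num) using 1
    module
  · convert (hP.2.add hQ.2).smul (show (0 : ℝ) ≤ 1 / 2 by norm_num) using 1
    module

/-- The nearest point of the constraint set exists and is unique. -/
theorem existsUnique_isFrobProj {d : ℕ} {τ ζ : ℝ} (hτ : 0 < τ) (hτζ : τ ≤ ζ)
    (A : Matrix (Fin d) (Fin d) ℝ) : ∃! P, IsFrobProj (covSet d τ ζ) A P := by
  apply existsUnique_of_exists_of_unique
  · let e : Matrix (Fin d) (Fin d) ℝ → EuclideanSpace ℝ (Fin d × Fin d) :=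
      fun M => WithLp.toLp 2 fun p => M p.1 p.2
    let e' : EuclideanSpace ℝ (Fin d × Fin d) → Matrix (Fin d) (Fin d) ℝ :=
      fun v => Matrix.of fun i j => v (i, j)
    have he' : Continuous e' := by
      refine continuous_matrix fun i j => ?_
      simp only [e', Matrix.of_apply]
      fun_prop
    have hee : ∀ M, e' (e M) = M := fun M => rfl
    have hdist : ∀ M N, dist (e M) (e N) = frobNorm (M - N) := fun M N => by
      simp [EuclideanSpace.dist_eq, frobNorm, e, Fintype.sum_prod_type, Real.dist_eq, sq_abs]
    have hne : (e' ⁻¹' covSet d τ ζ).Nonempty := by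
      obtain ⟨M, hM⟩ := covSet_nonempty d hτ hτζ
      exact ⟨e M, by simpa [hee] using hM⟩
    obtain ⟨v, hv, hmin⟩ :=
      ((isClosed_covSet d τ ζ).preimage he').exists_infDist_eq_dist hne (e A)
    refine ⟨e' v, hv, fun X hX => ?_⟩
    have h1 := Metric.infDist_le_dist_of_mem (x := e A)
      (show e X ∈ e' ⁻¹' covSet d τ ζ by simpa [hee] using hX)
    rw [hmin] at h1
    rw [← hdist, ← hdist]
    exact h1
  · rintro P Q ⟨hP, hPm⟩ ⟨hQ, hQm⟩
    have hM := midpoint_mem_covSet hP hQ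
    have h1 := pow_le_pow_left₀ (Real.sqrt_nonneg _) (hPm _ hM) 2
    have h2 := pow_le_pow_left₀ (Real.sqrt_nonneg _) (hQm _ hM) 2
    change frobNorm _ ^ 2 ≤ frobNorm _ ^ 2 at h1 h2
    rw [frobNorm_sq, frobNorm_sq] at h1 h2
    have h3 : ∑ i, ∑ j, (A - (1 / 2 : ℝ) • (P + Q)) i j ^ 2
        = (∑ i, ∑ j, (A - P) i j ^ 2 + ∑ i, ∑ j, (A - Q) i j ^ 2) / 2
          - (∑ i, ∑ j, (P i j - Q i j) ^ 2) / 4 := by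
      simp only [Finset.sum_div, ← Finset.sum_add_distrib, ← Finset.sum_sub_distrib]
      refine Finset.sum_congr rfl fun i _ => Finset.sum_congr rfl fun j _ => ?_
      simp only [Matrix.sub_apply, Matrix.smul_apply, Matrix.add_apply, smul_eq_mul]
      ring
    have h4 : ∑ i, ∑ j, (P i j - Q i j) ^ 2 ≤ 0 := by linarith
    ext i j
    have h5 : (P i j - Q i j) ^ 2 ≤ ∑ i, ∑ j, (P i j - Q i j) ^ 2 :=
      (Finset.single_le_sum (f := fun j => (P i j - Q i j) ^ 2)
        (fun _ _ => sq_nonneg _) (Finset.mem_univ j)).trans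
      (Finset.single_le_sum (f := fun i => ∑ j, (P i j - Q i j) ^ 2)
        (fun _ _ => Finset.sum_nonneg fun _ _ => sq_nonneg _) (Finset.mem_univ i))
    nlinarith [sq_nonneg (P i j - Q i j), pow_eq_zero_iff (two_ne_zero) |>.1
      (le_antisymm (h5.trans h4) (sq_nonneg (P i j - Q i j)))]

/-- The Frobenius-norm projection onto the constraint set: the unique nearest point, whose
existence for `0 < τ ≤ ζ` is `existsUnique_isFrobProj`. -/
def frobProj (d : ℕ) (τ ζ : ℝ) (A : Matrix (Fin d) (Fin d) ℝ) : Matrix (Fin d) (Fin d) ℝ :=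
  Classical.epsilon fun P => IsFrobProj (covSet d τ ζ) A P

theorem isFrobProj_frobProj {d : ℕ} {τ ζ : ℝ} (hτ : 0 < τ) (hτζ : τ ≤ ζ)
    (A : Matrix (Fin d) (Fin d) ℝ) : IsFrobProj (covSet d τ ζ) A (frobProj d τ ζ A) :=
  Classical.epsilon_spec (existsUnique_isFrobProj hτ hτζ A).exists

/-- The dimensional factor `(d³ + 6 d² + 8 d)^(5/6) + d (d² + 2 d)^(3/4)`. -/
def dimFactor (d : ℕ) : ℝ :=
  ((d : ℝ) ^ 3 + 6 * (d : ℝ) ^ 2 + 8 * (d : ℝ)) ^ (5 / 6 : ℝ)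
    + (d : ℝ) * ((d : ℝ) ^ 2 + 2 * (d : ℝ)) ^ (3 / 4 : ℝ)

end RegularizedES

end

namespace RegularizedES

open MeasureTheory ProbabilityTheory Matrix

/-! Write `H̄` for the expected Hessian of `f` under `N(μ, α²Σ)` (`meanHessian`). Moving the
covariance along a segment changes the Gaussian smoothing at the rate `½⟪H̄, ·⟫`, and `log det` has
derivative `⟪Σ⁻¹, ·⟫`. A minimizer `Σ` over the constraint set therefore satisfies `⟪H̄ - Σ⁻¹, S -
Σ⟫ ≥ 0` for every admissible `S` (`frobInner_meanHessian_sub_inv_nonneg`). Clipping the eigenvalues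
of `H̄⁻¹` solves this inequality and also the one that characterizes the projection of `H̄⁻¹`
(`exists_clip`). Since the former has at most one solution, `Σ = Π(H̄⁻¹)`
(`eq_frobProj_inv_meanHessian`).

The first bound now follows from three Lipschitz estimates: the projection is nonexpansive,
inversion is `σ⁻²`-Lipschitz on matrices `⪰ σI`, and `H̄` is within `γαd/√τ` of the Hessian at the
mean.

For the second bound, the same estimates compare the two expected Hessians through the Hessians at
the two means. Optimality in the mean gives `‖∇f(μ̂)‖ ≤ γ tr(α²Σ̂)`, so strong convexity puts `μ̂`
within `γα²d/(στ)` of the minimizer of `f` (`norm_sub_minimizer_le`). The resulting term is of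
second order in `α`; the restriction on `α` absorbs it into the slack of `5 d^(3/2) ≤ P_d`
(`mul_sqrt_le_dimFactor`). The square-root term of the claim is not needed. -/

/-- The Frobenius inner product of two real square matrices. -/
def frobInner {d : ℕ} (A B : Matrix (Fin d) (Fin d) ℝ) : ℝ := ∑ i, ∑ j, A i j * B i j

/-- A square matrix as a vector of the Euclidean space of its entries. -/
def entryVec {d : ℕ} (A : Matrix (Fin d) (Fin d) ℝ) : EuclideanSpace ℝ (Fin d × Fin d) :=
  WithLp.toLp 2 fun p => A p.1 p.2

/-! ### Frobenius geometry of matrices. -/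

section Frobenius

variable {d : ℕ} (A B C : Matrix (Fin d) (Fin d) ℝ)

lemma norm_entryVec : ‖entryVec A‖ = frobNorm A := by
  simp [EuclideanSpace.norm_eq, frobNorm, entryVec, Fintype.sum_prod_type, sq_abs]

lemma inner_entryVec : inner ℝ (entryVec A) (entryVec B) = frobInner A B := by
  simp [PiLp.inner_apply, frobInner, entryVec, Fintype.sum_prod_type, mul_comm]

lemma frobNorm_nonneg : 0 ≤ frobNorm A := Real.sqrt_nonneg _

lemma abs_frobInner_le : |frobInner A B| ≤ frobNorm A * frobNorm B := by
  rw [← inner_entryVec, ← norm_entryVec, ← norm_entryVec]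
  exact abs_real_inner_le_norm _ _

lemma frobNorm_add_le : frobNorm (A + B) ≤ frobNorm A + frobNorm B := by
  simp only [← norm_entryVec]
  exact norm_add_le (entryVec A) (entryVec B)

lemma frobNorm_sub_comm : frobNorm (A - B) = frobNorm (B - A) := by
  simp only [← norm_entryVec]
  exact norm_sub_rev (entryVec A) (entryVec B)

lemma frobNorm_sub_le : frobNorm (A - C) ≤ frobNorm (A - B) + frobNorm (B - C) := by
  simpa using frobNorm_add_le (A - B) (B - C)

lemma frobInner_self : frobInner A A = frobNorm A ^ 2 := by
  rw [frobNorm_sq]; simp [frobInner, sq]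

lemma eq_zero_of_frobNorm_eq_zero (h : frobNorm A = 0) : A = 0 := by
  rw [← norm_entryVec, norm_eq_zero] at h
  ext i j
  exact congrArg (fun v : EuclideanSpace ℝ (Fin d × Fin d) => v (i, j)) h

lemma frobInner_comm : frobInner A B = frobInner B A := by simp [frobInner, mul_comm]

lemma frobInner_sub_left : frobInner (A - B) C = frobInner A C - frobInner B C := by
  simp [frobInner, sub_mul, Finset.sum_sub_distrib]

lemma frobInner_sub_right : frobInner A (B - C) = frobInner A B - frobInner A C := by
  simp [frobInner, mul_sub, Finset.sum_sub_distrib]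

lemma frobInner_eq_trace : frobInner A B = (Aᵀ * B).trace := by
  simp only [frobInner, trace, diag, mul_apply, transpose_apply]
  exact Finset.sum_comm

lemma frobNorm_transpose : frobNorm Aᵀ = frobNorm A := by
  simp only [frobNorm, transpose_apply]
  rw [Finset.sum_comm]

lemma frobNorm_sq_eq_sum_norm_col :
    frobNorm A ^ 2 = ∑ j, ‖(WithLp.toLp 2 (A.col j) : EuclideanSpace ℝ (Fin d))‖ ^ 2 := by
  rw [frobNorm_sq, Finset.sum_comm]
  simp [EuclideanSpace.norm_sq_eq, col]

variable {A B}

/-- The squared Frobenius norm is the sum over columns, and left multiplication by `A` acts on each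
column separately. -/
lemma frobNorm_mul_le {c : ℝ} (hc : 0 ≤ c)
    (hA : ∀ v : EuclideanSpace ℝ (Fin d), ‖toEuclideanCLM (n := Fin d) (𝕜 := ℝ) A v‖ ≤ c * ‖v‖) :
    frobNorm (A * B) ≤ c * frobNorm B := by
  refine (sq_le_sq₀ (frobNorm_nonneg _) (mul_nonneg hc (frobNorm_nonneg _))).1 ?_
  rw [mul_pow, frobNorm_sq_eq_sum_norm_col, frobNorm_sq_eq_sum_norm_col, Finset.mul_sum]
  refine Finset.sum_le_sum fun j _ => ?_
  rw [← mul_pow]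
  refine pow_le_pow_left₀ (norm_nonneg _) ?_ 2
  have h : (WithLp.toLp 2 ((A * B).col j) : EuclideanSpace ℝ (Fin d))
      = toEuclideanCLM (n := Fin d) (𝕜 := ℝ) A (WithLp.toLp 2 (B.col j)) := by
    ext i
    simp [toEuclideanCLM_toLp, mul_apply, mulVec, dotProduct]
  rw [h]
  exact hA _

lemma frobNorm_le_sqrt_mul {c : ℝ} (hc : 0 ≤ c)
    (hA : ∀ v : EuclideanSpace ℝ (Fin d), ‖toEuclideanCLM (n := Fin d) (𝕜 := ℝ) A v‖ ≤ c * ‖v‖) :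
    frobNorm A ≤ Real.sqrt d * c := by
  have h := frobNorm_mul_le (B := 1) hc hA
  have h1 : frobNorm (1 : Matrix (Fin d) (Fin d) ℝ) = Real.sqrt d := by
    simp [frobNorm, one_apply]
  rwa [mul_one, h1, mul_comm] at h

end Frobenius

/-! ### Inversion on matrices bounded below by `σI`. -/

section Inverse

variable {d : ℕ} {A B : Matrix (Fin d) (Fin d) ℝ} {σ : ℝ}

lemma posDef_of_sub_smul_one (hσ : 0 < σ)
    (hA : (A - σ • (1 : Matrix (Fin d) (Fin d) ℝ)).PosSemidef) : A.PosDef := by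
  simpa using PosDef.posSemidef_add hA (PosDef.one.smul hσ)

/-- With `w = A⁻¹v`, coercivity and Cauchy–Schwarz give `σ‖w‖² ≤ ⟪w, Aw⟫ = ⟪w, v⟫ ≤ ‖w‖‖v‖`. -/
lemma norm_inv_apply_le (hσ : 0 < σ)
    (hA : (A - σ • (1 : Matrix (Fin d) (Fin d) ℝ)).PosSemidef) (v : EuclideanSpace ℝ (Fin d)) :
    ‖toEuclideanCLM (n := Fin d) (𝕜 := ℝ) A⁻¹ v‖ ≤ σ⁻¹ * ‖v‖ := by
  have hdet := (posDef_of_sub_smul_one hσ hA).isUnit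
  rw [isUnit_iff_isUnit_det] at hdet
  set w := toEuclideanCLM (n := Fin d) (𝕜 := ℝ) A⁻¹ v with hw
  have hv : toEuclideanCLM (n := Fin d) (𝕜 := ℝ) A w = v := by
    rw [hw, ← ContinuousLinearMap.comp_apply, ← ContinuousLinearMap.mul_def, ← map_mul,
      mul_nonsing_inv _ hdet]
    simp
  have h1 := ((posSemidef_real_iff _).1 hA).2 w
  rw [← inner_toEuclideanCLM, map_sub, map_smul, map_one, _root_.sub_apply, hv,
    inner_sub_right] at h1
  simp only [_root_.smul_apply, one_apply_eq_self, inner_smul_right,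
    real_inner_self_eq_norm_sq] at h1
  have h2 := real_inner_le_norm w v
  rw [inv_mul_eq_div, le_div_iff₀ hσ]
  rcases (norm_nonneg w).eq_or_lt with h0 | h0
  · rw [← h0]; simp
  · nlinarith

/-- Resolvent identity `A⁻¹ - B⁻¹ = A⁻¹(B - A)B⁻¹`, each inverse costing a factor `σ⁻¹`. -/
lemma frobNorm_inv_sub_inv_le (hσ : 0 < σ)
    (hA : (A - σ • (1 : Matrix (Fin d) (Fin d) ℝ)).PosSemidef)
    (hB : (B - σ • (1 : Matrix (Fin d) (Fin d) ℝ)).PosSemidef) :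
    frobNorm (A⁻¹ - B⁻¹) ≤ (σ ^ 2)⁻¹ * frobNorm (A - B) := by
  have hAp := posDef_of_sub_smul_one hσ hA
  have hBp := posDef_of_sub_smul_one hσ hB
  have hdA := (isUnit_iff_isUnit_det _).1 hAp.isUnit
  have hdB := (isUnit_iff_isUnit_det _).1 hBp.isUnit
  have h1 : A⁻¹ - B⁻¹ = A⁻¹ * ((B - A) * B⁻¹) := by
    rw [sub_mul, mul_nonsing_inv _ hdB, mul_sub, mul_one, ← mul_assoc, nonsing_inv_mul _ hdA,
      one_mul]
  have hBt : (B⁻¹)ᵀ = B⁻¹ := by simpa using hBp.inv.isHermitian.eq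
  have h2 : frobNorm ((B - A) * B⁻¹) ≤ σ⁻¹ * frobNorm (A - B) := by
    -- Transposing turns the right factor `B⁻¹` into a left one, where `frobNorm_mul_le` applies.
    rw [← frobNorm_transpose, transpose_mul, hBt, frobNorm_sub_comm A, ← frobNorm_transpose (B - A)]
    exact frobNorm_mul_le (inv_nonneg.2 hσ.le) (norm_inv_apply_le hσ hB)
  rw [h1, sq, mul_inv, mul_assoc]
  exact (frobNorm_mul_le (inv_nonneg.2 hσ.le) (norm_inv_apply_le hσ hA)).trans
    (mul_le_mul_of_nonneg_left h2 (inv_nonneg.2 hσ.le))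

end Inverse

/-! ### Projection onto the constraint set and its variational inequalities. -/

section CovSet

variable {d : ℕ} {τ ζ : ℝ} {A B P Q S H : Matrix (Fin d) (Fin d) ℝ}

lemma posDef_of_mem_covSet (hζ : 0 < ζ) (hS : S ∈ covSet d τ ζ) : S.PosDef :=
  posDef_of_sub_smul_one (inv_pos.2 hζ) hS.1

lemma trace_le_of_mem_covSet (hS : S ∈ covSet d τ ζ) : S.trace ≤ d / τ := by
  have := hS.2.trace_nonneg
  simp at this
  rw [div_eq_inv_mul]; linarith

lemma covSet_combo {a b : ℝ} (ha : 0 ≤ a) (hb : 0 ≤ b) (hab : a + b = 1)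
    (hP : P ∈ covSet d τ ζ) (hQ : Q ∈ covSet d τ ζ) : a • P + b • Q ∈ covSet d τ ζ := by
  obtain rfl : b = 1 - a := by linarith
  constructor
  · convert (hP.1.smul ha).add (hQ.1.smul hb) using 1
    module
  · convert (hP.2.smul ha).add (hQ.2.smul hb) using 1
    module

/-- Expand `‖A - X‖² = ‖A - P‖² + 2⟪P - A, X - P⟫ + ‖X - P‖²`. -/
lemma eq_frobProj_of_frobInner_nonneg (hτ : 0 < τ) (hτζ : τ ≤ ζ) (hP : P ∈ covSet d τ ζ)
    (h : ∀ S ∈ covSet d τ ζ, 0 ≤ frobInner (P - A) (S - P)) : P = frobProj d τ ζ A := by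
  refine (existsUnique_isFrobProj hτ hτζ A).unique ⟨hP, fun X hX => ?_⟩
    (isFrobProj_frobProj hτ hτζ A)
  have h1 := h X hX
  have h2 : frobInner (X - P) (X - P) = frobNorm (X - P) ^ 2 := frobInner_self _
  refine (sq_le_sq₀ (frobNorm_nonneg _) (frobNorm_nonneg _)).1 ?_
  rw [← frobInner_self, ← frobInner_self]
  have h3 := sq_nonneg (frobNorm (X - P))
  rw [← h2] at h3
  simp only [frobInner_sub_left, frobInner_sub_right] at *
  linarith [frobInner_comm A P, frobInner_comm A X, frobInner_comm P X]

/-- Adding the two inequalities gives `‖P - Q‖² ≤ ⟪A - B, P - Q⟫`; Cauchy–Schwarz finishes. This is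
nonexpansiveness of the projection. -/
lemma frobNorm_sub_le_of_frobInner_nonneg (hP : 0 ≤ frobInner (P - A) (Q - P))
    (hQ : 0 ≤ frobInner (Q - B) (P - Q)) : frobNorm (P - Q) ≤ frobNorm (A - B) := by
  have h1 := (le_abs_self _).trans (abs_frobInner_le (A - B) (P - Q))
  have h2 := frobInner_self (P - Q)
  have h3 : frobNorm (P - Q) ^ 2 ≤ frobNorm (A - B) * frobNorm (P - Q) := by
    simp only [frobInner_sub_left, frobInner_sub_right] at *
    linarith
  rcases (frobNorm_nonneg (P - Q)).eq_or_lt with h0 | h0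
  · rw [← h0]; exact frobNorm_nonneg _
  · exact le_of_mul_le_mul_right (by linarith) h0

/-- The Rayleigh quotients of a matrix of the constraint set at the rows of an orthogonal matrix
lie between the two bounds. -/
lemma mem_Icc_of_mem_covSet (hS : S ∈ covSet d τ ζ) {U : Matrix (Fin d) (Fin d) ℝ}
    (hU : Uᵀ * U = 1) (i : Fin d) : (Uᵀ * S * U) i i ∈ Set.Icc ζ⁻¹ τ⁻¹ := by
  have h1 := (hS.1.conjTranspose_mul_mul_same U).diag_nonneg (i := i)
  have h2 := (hS.2.conjTranspose_mul_mul_same U).diag_nonneg (i := i)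
  simp [mul_sub, sub_mul, hU] at h1 h2
  exact ⟨by linarith, by linarith⟩

/-- Reduces a variational inequality between matrices with a common eigenbasis to scalar
inequalities, since only the diagonal of `S` in that basis enters. -/
lemma frobInner_conj_diagonal {U : Matrix (Fin d) (Fin d) ℝ} (hU : Uᵀ * U = 1) (c p : Fin d → ℝ) :
    frobInner (U * diagonal c * Uᵀ) (S - U * diagonal p * Uᵀ)
      = ∑ i, c i * ((Uᵀ * S * U) i i - p i) := by
  have h : (U * diagonal c * Uᵀ)ᵀ * (S - U * diagonal p * Uᵀ)
      = U * (diagonal c * (Uᵀ * S - diagonal p * Uᵀ)) := by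
    simp only [transpose_mul, diagonal_transpose, transpose_transpose, mul_assoc, mul_sub]
    rw [← mul_assoc Uᵀ U, hU, one_mul]
  rw [frobInner_eq_trace, h, trace_mul_comm, mul_assoc, sub_mul, mul_assoc (diagonal p), hU,
    mul_one]
  simp [trace, diagonal_mul]

/-- For positive definite `H`, spectral clipping of `H⁻¹` solves both the variational inequality of
the Frobenius projection of `H⁻¹` and that of `⟪H, S⟫ - log det S`. -/
lemma exists_clip (hτ : 0 < τ) (hτζ : τ ≤ ζ) (hH : H.PosDef) :
    ∃ P ∈ covSet d τ ζ, (∀ S ∈ covSet d τ ζ, 0 ≤ frobInner (P - H⁻¹) (S - P)) ∧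
      ∀ S ∈ covSet d τ ζ, 0 ≤ frobInner (H - P⁻¹) (S - P) := by
  have hζ : 0 < ζ := hτ.trans_le hτζ
  have hζτ : ζ⁻¹ ≤ τ⁻¹ := inv_anti₀ hτ hτζ
  obtain ⟨U, h, hpos, hU, hU', rfl⟩ : ∃ (U : Matrix (Fin d) (Fin d) ℝ) (h : Fin d → ℝ),
      (∀ i, 0 < h i) ∧ Uᵀ * U = 1 ∧ U * Uᵀ = 1 ∧ H = U * diagonal h * Uᵀ := by
    refine ⟨hH.isHermitian.eigenvectorUnitary, hH.isHermitian.eigenvalues, hH.eigenvalues_pos,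
      ?_, ?_, ?_⟩
    · exact Unitary.coe_star_mul_self hH.isHermitian.eigenvectorUnitary
    · exact Unitary.coe_mul_star_self hH.isHermitian.eigenvectorUnitary
    · exact hH.isHermitian.spectral_theorem
  have hinv : ∀ c : Fin d → ℝ, (∀ i, 0 < c i) →
      (U * diagonal c * Uᵀ)⁻¹ = U * diagonal (fun i => (c i)⁻¹) * Uᵀ := fun c hc => by
    refine inv_eq_right_inv ?_
    calc U * diagonal c * Uᵀ * (U * diagonal (fun i => (c i)⁻¹) * Uᵀ)
        = U * (diagonal c * (Uᵀ * U) * diagonal (fun i => (c i)⁻¹)) * Uᵀ := by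
          simp only [mul_assoc]
      _ = 1 := by
          have : (fun i => c i * (c i)⁻¹) = fun _ => 1 :=
            funext fun i => mul_inv_cancel₀ (hc i).ne'
          rw [hU, mul_one, diagonal_mul_diagonal, this]
          simp [hU']
  have hsub : ∀ a b : Fin d → ℝ, U * diagonal a * Uᵀ - U * diagonal b * Uᵀ
      = U * diagonal (fun i => a i - b i) * Uᵀ := fun a b => by
    rw [← diagonal_sub, mul_sub, sub_mul]
  have hone : ∀ c : ℝ, c • (1 : Matrix (Fin d) (Fin d) ℝ) = U * diagonal (fun _ => c) * Uᵀ :=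
    fun c => by
      rw [← smul_one_eq_diagonal, Matrix.mul_smul, mul_one, Matrix.smul_mul, hU']
  -- The eigenvalues of `H⁻¹`, clipped to the interval `[ζ⁻¹, τ⁻¹]`.
  set p : Fin d → ℝ := fun i => max ζ⁻¹ (min τ⁻¹ (h i)⁻¹) with hp
  have hp1 : ∀ i, ζ⁻¹ ≤ p i := fun i => le_max_left _ _
  have hp2 : ∀ i, p i ≤ τ⁻¹ := fun i => max_le hζτ (min_le_left _ _)
  have hp0 : ∀ i, 0 < p i := fun i => (inv_pos.2 hζ).trans_le (hp1 i)
  have hpsd : ∀ c : Fin d → ℝ, (∀ i, 0 ≤ c i) → (U * diagonal c * Uᵀ).PosSemidef := fun c hc => by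
    simpa using (PosSemidef.diagonal (d := c) hc).mul_mul_conjTranspose_same U
  -- Variational inequality of the projection onto an interval, in the three positions of `(h i)⁻¹`.
  have key : ∀ i, ∀ s ∈ Set.Icc ζ⁻¹ τ⁻¹, 0 ≤ (p i - (h i)⁻¹) * (s - p i) := by
    rintro i s ⟨hs1, hs2⟩
    rcases le_total (h i)⁻¹ ζ⁻¹ with h1 | h1
    · have : p i = ζ⁻¹ := max_eq_left ((min_le_right _ _).trans h1)
      rw [this]
      exact mul_nonneg (by linarith) (by linarith)
    · rcases le_total (h i)⁻¹ τ⁻¹ with h2 | h2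
      · have : p i = (h i)⁻¹ := by simp [hp, h1, h2]
        simp [this]
      · have : p i = τ⁻¹ := by simp [hp, h2, hζτ]
        rw [this]
        exact mul_nonneg_of_nonpos_of_nonpos (by linarith) (by linarith)
  refine ⟨U * diagonal p * Uᵀ, ⟨?_, ?_⟩, fun S hS => ?_, fun S hS => ?_⟩
  · rw [hone, hsub]; exact hpsd _ fun i => sub_nonneg.2 (hp1 i)
  · rw [hone, hsub]; exact hpsd _ fun i => sub_nonneg.2 (hp2 i)
  · rw [hinv _ hpos, hsub, frobInner_conj_diagonal hU]
    exact Finset.sum_nonneg fun i _ => key i _ (mem_Icc_of_mem_covSet hS hU i)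
  · rw [hinv _ hp0, hsub, frobInner_conj_diagonal hU]
    refine Finset.sum_nonneg fun i _ => ?_
    have h1 := key i _ (mem_Icc_of_mem_covSet hS hU i)
    -- In each eigendirection the two gradients differ by a positive factor, so one `p` solves both
    -- problems.
    have h2 : h i - (p i)⁻¹ = (h i / p i) * (p i - (h i)⁻¹) := by
      have := (hp0 i).ne'
      have := (hpos i).ne'
      field_simp
    rw [h2, mul_assoc]
    exact mul_nonneg (div_pos (hpos i) (hp0 i)).le h1

open scoped MatrixOrder in
lemma exists_isUnit_transpose_mul_self (hP : P.PosDef) :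
    ∃ B : Matrix (Fin d) (Fin d) ℝ, IsUnit B ∧ P = Bᵀ * B := by
  obtain ⟨B, hB, rfl⟩ := CStarAlgebra.isStrictlyPositive_iff_eq_star_mul_self.mp
    hP.isStrictlyPositive
  exact ⟨B, hB, by rw [star_eq_conjTranspose, conjTranspose_eq_transpose_of_trivial]⟩

/-- Strict monotonicity of `P ↦ -P⁻¹`: the sum of the two inequalities gives `⟪P⁻¹ - Q⁻¹, Q - P⟫ ≤
0`, whereas this quantity is positive for `P ≠ Q`. -/
lemma eq_of_frobInner_sub_inv_nonneg (hP : P.PosDef) (hQ : Q.PosDef)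
    (h1 : 0 ≤ frobInner (H - P⁻¹) (Q - P)) (h2 : 0 ≤ frobInner (H - Q⁻¹) (P - Q)) : P = Q := by
  by_contra hne
  have hdP := (isUnit_iff_isUnit_det _).1 hP.isUnit
  have hdQ := (isUnit_iff_isUnit_det _).1 hQ.isUnit
  have hPt : (P⁻¹)ᵀ = P⁻¹ := by simpa using hP.inv.isHermitian.eq
  have hQt : (Q⁻¹)ᵀ = Q⁻¹ := by simpa using hQ.inv.isHermitian.eq
  have hDt : (Q - P)ᵀ = Q - P := by
    simpa using (hQ.isHermitian.sub hP.isHermitian).eq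
  have h3 : frobInner (P⁻¹ - Q⁻¹) (Q - P) ≤ 0 := by
    simp only [frobInner_sub_left, frobInner_sub_right] at *
    linarith
  have h4 : P⁻¹ - Q⁻¹ = P⁻¹ * (Q - P) * Q⁻¹ := by
    rw [mul_sub, sub_mul, nonsing_inv_mul _ hdP, one_mul, mul_assoc, mul_nonsing_inv _ hdQ,
      mul_one]
  obtain ⟨B, hB, hBP⟩ := exists_isUnit_transpose_mul_self hP.inv
  obtain ⟨C, hC, hCQ⟩ := exists_isUnit_transpose_mul_self hQ.inv
  -- Factoring `P⁻¹ = BᵀB` and `Q⁻¹ = CᵀC` exhibits the pairing as a square, by cyclicity of the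
  -- trace.
  have h5 : frobInner (P⁻¹ - Q⁻¹) (Q - P) = frobNorm (B * (Q - P) * Cᵀ) ^ 2 := by
    rw [← frobInner_self, frobInner_eq_trace, frobInner_eq_trace, h4, hBP, hCQ]
    simp only [transpose_mul, transpose_transpose, hDt]
    calc (Cᵀ * C * ((Q - P) * (Bᵀ * B)) * (Q - P)).trace
        = (Cᵀ * (C * ((Q - P) * (Bᵀ * B)) * (Q - P))).trace := by simp only [mul_assoc]
      _ = _ := by rw [trace_mul_comm]; simp only [mul_assoc]
  have h6 : frobNorm (B * (Q - P) * Cᵀ) = 0 :=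
    pow_eq_zero_iff (two_ne_zero) |>.1 (le_antisymm (h5 ▸ h3) (sq_nonneg _))
  have h7 : B * (Q - P) * Cᵀ = 0 := eq_zero_of_frobNorm_eq_zero _ h6
  have h8 : Q - P = 0 := by
    have hCt : IsUnit Cᵀ := by simpa using hC
    rw [hCt.mul_left_eq_zero] at h7
    rwa [hB.mul_right_eq_zero] at h7
  exact hne (sub_eq_zero.1 h8).symm

/-- If `P` minimizes, in the sense of its first-order condition, `⟪H, S⟫ - log det S` over the
constraint set, then it is the Frobenius projection of `H⁻¹`, which moreover satisfies the
variational inequality. -/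
lemma eq_frobProj_inv_of_frobInner_nonneg (hτ : 0 < τ) (hτζ : τ ≤ ζ) (hH : H.PosDef)
    (hP : P ∈ covSet d τ ζ) (h : ∀ S ∈ covSet d τ ζ, 0 ≤ frobInner (H - P⁻¹) (S - P)) :
    P = frobProj d τ ζ H⁻¹ := by
  obtain ⟨Q, hQ, h1, h2⟩ := exists_clip hτ hτζ hH
  have hζ := hτ.trans_le hτζ
  rw [eq_of_frobInner_sub_inv_nonneg (posDef_of_mem_covSet hζ hP) (posDef_of_mem_covSet hζ hQ)
    (h Q hQ) (h2 P hP)]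
  exact eq_frobProj_of_frobInner_nonneg hτ hτζ hQ h1

lemma frobNorm_frobProj_inv_sub_le (hτ : 0 < τ) (hτζ : τ ≤ ζ) (hA : A.PosDef) (hB : B.PosDef) :
    frobNorm (frobProj d τ ζ A⁻¹ - frobProj d τ ζ B⁻¹) ≤ frobNorm (A⁻¹ - B⁻¹) := by
  obtain ⟨P, hP, h1, -⟩ := exists_clip hτ hτζ hA
  obtain ⟨Q, hQ, h2, -⟩ := exists_clip hτ hτζ hB
  rw [← eq_frobProj_of_frobInner_nonneg hτ hτζ hP h1, ← eq_frobProj_of_frobInner_nonneg hτ hτζ hQ h2]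
  exact frobNorm_sub_le_of_frobInner_nonneg (h1 Q hQ) (h2 P hP)

end CovSet

/-! ### Directional derivative of `log det`. -/

section LogDet

variable {d : ℕ} {P : Matrix (Fin d) (Fin d) ℝ}

lemma hasDerivAt_log_det (hP : P.PosDef) (T : Matrix (Fin d) (Fin d) ℝ) :
    HasDerivAt (fun t : ℝ => Real.log (P + t • T).det) (frobInner P⁻¹ T) 0 := by
  have hd := (isUnit_iff_isUnit_det _).1 hP.isUnit
  have hPt : (P⁻¹)ᵀ = P⁻¹ := by simpa using hP.inv.isHermitian.eq
  have h1 : ∀ t : ℝ, (P + t • T).det = P.det * (1 + t • (P⁻¹ * T)).det := fun t => by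
    rw [← det_mul, mul_add, mul_one, Matrix.mul_smul, ← mul_assoc, mul_nonsing_inv _ hd, one_mul]
  have h2 : HasDerivAt (fun t : ℝ => (1 + t • (P⁻¹ * T)).det) (P⁻¹ * T).trace 0 := by
    rw [funext fun t : ℝ => det_one_add_smul t (P⁻¹ * T)]
    -- `det (1 + tX) = 1 + t tr X + q(t) t²`, so `q` contributes nothing to the derivative at `0`.
    set q := (1 + (Polynomial.X : Polynomial ℝ) • (P⁻¹ * T).map Polynomial.C).det.divX.divX
    have := (((hasDerivAt_id (0 : ℝ)).const_mul (P⁻¹ * T).trace).const_add 1).add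
      ((q.hasDerivAt 0).mul ((hasDerivAt_id (0 : ℝ)).pow 2))
    exact this.congr_deriv (by simp)
  have h3 := (h2.const_mul P.det).log (by simpa using hd.ne_zero)
  simp only [← h1] at h3
  convert h3 using 1
  rw [frobInner_eq_trace, hPt]
  have := hd.ne_zero
  simp
  field_simp

end LogDet

end RegularizedES

namespace RegularizedES

open MeasureTheory ProbabilityTheory Matrix

/-! ### Gaussian moments and sums of independent Gaussians. -/

section Gaussian

variable {d : ℕ} {F : Type*} [NormedAddCommGroup F] {μ : EuclideanSpace ℝ (Fin d)}
  {S T : Matrix (Fin d) (Fin d) ℝ}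

lemma integrable_norm_pow_of_isGaussian (ν : Measure (EuclideanSpace ℝ (Fin d))) [IsGaussian ν]
    (n : ℕ) : Integrable (fun x => ‖x‖ ^ n) ν :=
  (IsGaussian.memLp_id ν n (by simp)).integrable_norm_pow'

/-- A continuous function of at most cubic growth is integrable for a Gaussian measure. -/
lemma integrable_of_cubic_growth (ν : Measure (EuclideanSpace ℝ (Fin d))) [IsGaussian ν]
    {g : EuclideanSpace ℝ (Fin d) → F} (hg : Continuous g) {a b c e : ℝ}
    (h : ∀ x, ‖g x‖ ≤ a + b * ‖x‖ + c * ‖x‖ ^ 2 + e * ‖x‖ ^ 3) : Integrable g ν := by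
  have hN := integrable_norm_pow_of_isGaussian ν
  have h1 : Integrable (fun x => a + b * ‖x‖ + c * ‖x‖ ^ 2 + e * ‖x‖ ^ 3) ν := by
    have := (hN 1).const_mul b
    simp only [pow_one] at this
    exact (((integrable_const a).add this).add ((hN 2).const_mul c)).add ((hN 3).const_mul e)
  exact h1.mono' hg.aestronglyMeasurable (Filter.Eventually.of_forall h)

/-- Compare characteristic functions. Splitting the noise into independent parts allows covariances
to be interpolated without differentiating a density. -/
lemma map_prod_multivariateGaussian (hS : S.PosSemidef) (hT : T.PosSemidef) (a b : ℝ) :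
    ((multivariateGaussian 0 S).prod (multivariateGaussian 0 T)).map
      (fun p => μ + (a • p.1 + b • p.2)) = multivariateGaussian μ (a ^ 2 • S + b ^ 2 • T) := by
  have hm : Measurable fun p : EuclideanSpace ℝ (Fin d) × EuclideanSpace ℝ (Fin d) =>
      μ + (a • p.1 + b • p.2) := by fun_prop
  have : IsProbabilityMeasure (((multivariateGaussian 0 S).prod (multivariateGaussian 0 T)).map
      (fun p => μ + (a • p.1 + b • p.2))) := Measure.isProbabilityMeasure_map hm.aemeasurable
  apply Measure.ext_of_charFun
  ext t
  have hST : (a ^ 2 • S + b ^ 2 • T).PosSemidef := (hS.smul (sq_nonneg a)).add (hT.smul (sq_nonneg b))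
  have h1 : ∀ p : EuclideanSpace ℝ (Fin d) × EuclideanSpace ℝ (Fin d),
      Complex.exp ((inner ℝ (μ + (a • p.1 + b • p.2)) t : ℝ) * Complex.I)
        = Complex.exp ((inner ℝ μ t : ℝ) * Complex.I) *
          (Complex.exp ((inner ℝ p.1 (a • t) : ℝ) * Complex.I) *
            Complex.exp ((inner ℝ p.2 (b • t) : ℝ) * Complex.I)) := fun p => by
    rw [← Complex.exp_add, ← Complex.exp_add]
    congr 1
    simp only [inner_add_left, real_inner_smul_left, real_inner_smul_right]
    push_cast
    ring
  rw [charFun_apply, integral_map hm.aemeasurable (by fun_prop)]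
  simp_rw [h1]
  rw [integral_const_mul,
    integral_prod_mul (f := fun x => Complex.exp ((inner ℝ x (a • t) : ℝ) * Complex.I))
      (g := fun x => Complex.exp ((inner ℝ x (b • t) : ℝ) * Complex.I)),
    ← charFun_apply, ← charFun_apply, charFun_multivariateGaussian hS,
    charFun_multivariateGaussian hT, charFun_multivariateGaussian hST, ← Complex.exp_add,
    ← Complex.exp_add, real_inner_comm]
  congr 1
  simp only [inner_zero_right, WithLp.ofLp_smul, mulVec_smul, dotProduct_smul, smul_dotProduct,
    add_mulVec, smul_mulVec, dotProduct_add, smul_eq_mul]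
  push_cast
  ring

lemma map_add_multivariateGaussian :
    (multivariateGaussian 0 S).map (fun x => μ + x) = multivariateGaussian μ S := by
  rw [multivariateGaussian, multivariateGaussian, Measure.map_map (by fun_prop) (by fun_prop)]
  congr 1
  ext x
  simp

lemma integral_multivariateGaussian_eq [NormedSpace ℝ F] {g : EuclideanSpace ℝ (Fin d) → F}
    (hg : Continuous g) :
    ∫ x, g x ∂multivariateGaussian μ S = ∫ x, g (μ + x) ∂multivariateGaussian 0 S := by
  rw [← map_add_multivariateGaussian, integral_map (by fun_prop) hg.aestronglyMeasurable]

lemma integrable_coord_mul (ν : Measure (EuclideanSpace ℝ (Fin d))) [IsGaussian ν] (i j : Fin d) :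
    Integrable (fun x : EuclideanSpace ℝ (Fin d) => x i * x j) ν := by
  refine integrable_of_cubic_growth ν (by fun_prop) (a := 0) (b := 0) (c := 1) (e := 0)
    fun x => ?_
  have hi := PiLp.norm_apply_le x i
  have hj := PiLp.norm_apply_le x j
  rw [norm_mul]
  calc ‖x i‖ * ‖x j‖ ≤ ‖x‖ * ‖x‖ := mul_le_mul hi hj (norm_nonneg _) (norm_nonneg _)
    _ = _ := by ring

lemma integral_inner_multivariateGaussian (v : EuclideanSpace ℝ (Fin d)) :
    ∫ x, inner ℝ v x ∂multivariateGaussian 0 S = 0 := by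
  have h := integral_inner (𝕜 := ℝ) (μ := multivariateGaussian 0 S) (f := fun x => x)
    IsGaussian.integrable_fun_id v
  rw [integral_id_multivariateGaussian] at h
  simpa using h

lemma integral_coord_mul (hS : S.PosSemidef) (i j : Fin d) :
    ∫ x, x i * x j ∂multivariateGaussian 0 S = S i j := by
  have h0 : ∀ i : Fin d, ∫ x, x i ∂multivariateGaussian 0 S = 0 := fun i => by
    have := integral_inner_multivariateGaussian (S := S) (EuclideanSpace.basisFun (Fin d) ℝ i)
    simpa [PiLp.inner_apply] using this
  have h := covariance_eval_multivariateGaussian (μ := 0) hS i j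
  simpa [covariance, h0] using h

lemma integral_quadratic (hS : S.PosSemidef) (H : Matrix (Fin d) (Fin d) ℝ) :
    ∫ x, inner ℝ x (toEuclideanCLM (n := Fin d) (𝕜 := ℝ) H x) ∂multivariateGaussian 0 S
      = frobInner H S := by
  have h : ∀ x : EuclideanSpace ℝ (Fin d), inner ℝ x (toEuclideanCLM (n := Fin d) (𝕜 := ℝ) H x)
      = ∑ i, ∑ j, H i j * (x i * x j) := fun x => by
    rw [inner_toEuclideanCLM]
    simp only [dotProduct, mulVec, Finset.mul_sum]
    exact Finset.sum_congr rfl fun i _ => Finset.sum_congr rfl fun j _ => by ring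
  simp_rw [h]
  refine (integral_finsetSum _ fun i _ => integrable_finsetSum _ fun j _ =>
    (integrable_coord_mul _ i j).const_mul (H i j)).trans (Finset.sum_congr rfl fun i _ => ?_)
  refine (integral_finsetSum _ fun j _ => (integrable_coord_mul _ i j).const_mul (H i j)).trans
    (Finset.sum_congr rfl fun j _ => ?_)
  rw [integral_const_mul, integral_coord_mul hS]

lemma integral_norm_sq (hS : S.PosSemidef) :
    ∫ x, ‖x‖ ^ 2 ∂multivariateGaussian 0 S = S.trace := by
  have h := integral_quadratic hS 1
  simpa [frobInner_eq_trace] using h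

end Gaussian

end RegularizedES

namespace RegularizedES

open MeasureTheory ProbabilityTheory Matrix

/-! ### Hessian facts and Taylor estimates. -/

section Taylor

variable {d : ℕ} {f : EuclideanSpace ℝ (Fin d) → ℝ} {L σ γ : ℝ}

lemma toEuclideanCLM_hessian (x : EuclideanSpace ℝ (Fin d)) :
    toEuclideanCLM (n := Fin d) (𝕜 := ℝ) (hessian f x) = fderiv ℝ (gradient f) x := by
  simp [hessian]

lemma hessian_apply (x : EuclideanSpace ℝ (Fin d)) (i j : Fin d) :
    hessian f x i j = fderiv ℝ (gradient f) x (EuclideanSpace.single j 1) i := by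
  rw [← toEuclideanCLM_hessian, ofLp_toEuclideanCLM]
  simp

lemma HasLipschitzHessian.norm_sub_le (h : HasLipschitzHessian γ f)
    (x y : EuclideanSpace ℝ (Fin d)) :
    ‖fderiv ℝ (gradient f) x - fderiv ℝ (gradient f) y‖ ≤ γ * ‖x - y‖ := by
  simpa [toEuclideanCLM_hessian] using h.2.2 x y

lemma HasLipschitzHessian.hasFDerivAt (h : HasLipschitzHessian γ f)
    (x : EuclideanSpace ℝ (Fin d)) : HasFDerivAt f (innerSL ℝ (gradient f x)) x := by
  exact (h.1 x).hasGradientAt.hasFDerivAt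

lemma HasLipschitzHessian.inner_symm (h : HasLipschitzHessian γ f)
    (x v w : EuclideanSpace ℝ (Fin d)) :
    inner ℝ (fderiv ℝ (gradient f) x v) w = inner ℝ v (fderiv ℝ (gradient f) x w) := by
  have h1 := (innerSL ℝ (E := EuclideanSpace ℝ (Fin d))).hasFDerivAt.comp x (h.2.1 x).hasFDerivAt
  have := second_derivative_symmetric (𝕜 := ℝ) (f' := fun y => innerSL ℝ (gradient f y))
    h.hasFDerivAt h1 v w
  rw [real_inner_comm _ v]
  exact this

lemma HasLipschitzHessian.transpose_hessian (h : HasLipschitzHessian γ f)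
    (x : EuclideanSpace ℝ (Fin d)) : (hessian f x)ᵀ = hessian f x := by
  ext i j
  have := h.inner_symm x (EuclideanSpace.single i 1) (EuclideanSpace.single j 1)
  rw [transpose_apply, hessian_apply, hessian_apply]
  simpa [PiLp.inner_apply] using this

lemma IsStronglyConvex.mul_norm_sq_le (h : IsStronglyConvex σ f) (x y : EuclideanSpace ℝ (Fin d)) :
    σ * ‖x - y‖ ^ 2 ≤ inner ℝ (gradient f x - gradient f y) (x - y) := by
  have h1 := h.2 x y
  have h2 := h.2 y x
  rw [norm_sub_rev y x, ← neg_sub x y, inner_neg_right] at h2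
  rw [inner_sub_left]
  linarith

lemma IsStronglyConvex.mul_norm_le (h : IsStronglyConvex σ f) (x y : EuclideanSpace ℝ (Fin d)) :
    σ * ‖x - y‖ ≤ ‖gradient f x - gradient f y‖ := by
  have h1 := (h.mul_norm_sq_le x y).trans (real_inner_le_norm _ _)
  rcases (norm_nonneg (x - y)).eq_or_lt with h0 | h0
  · rw [← h0]; simp
  · nlinarith

/-- Limit of the strong monotonicity of the gradient along difference quotients in the direction
`v`. -/
lemma IsStronglyConvex.mul_norm_sq_le_inner_fderiv (h : IsStronglyConvex σ f)
    (hf : Differentiable ℝ (gradient f)) (x v : EuclideanSpace ℝ (Fin d)) :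
    σ * ‖v‖ ^ 2 ≤ inner ℝ (fderiv ℝ (gradient f) x v) v := by
  have h1 : HasDerivAt (fun t : ℝ => gradient f (x + t • v)) (fderiv ℝ (gradient f) x v) 0 := by
    have hl : HasDerivAt (fun t : ℝ => x + t • v) v 0 := by
      simpa using ((hasDerivAt_id (0 : ℝ)).smul_const v).const_add x
    have hg : HasFDerivAt (gradient f) (fderiv ℝ (gradient f) x) (x + (0 : ℝ) • v) := by
      simpa using (hf x).hasFDerivAt
    exact hg.comp_hasDerivAt 0 hl
  have h2 := h1.tendsto_slope_zero_right
  have h3 := h2.inner (tendsto_const_nhds (x := v)) (𝕜 := ℝ)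
  refine ge_of_tendsto h3 ?_
  filter_upwards [self_mem_nhdsWithin] with t (ht : 0 < t)
  have h4 := h.mul_norm_sq_le (x + t • v) x
  rw [add_sub_cancel_left, norm_smul, real_inner_smul_right, mul_pow, Real.norm_eq_abs,
    sq_abs] at h4
  rw [real_inner_smul_left]
  simp only [zero_add, zero_smul, add_zero]
  rw [← mul_le_mul_iff_right₀ ht, ← mul_le_mul_iff_right₀ ht]
  calc t * (t * (σ * ‖v‖ ^ 2)) = σ * (t ^ 2 * ‖v‖ ^ 2) := by ring
    _ ≤ _ := h4
    _ = _ := by field_simp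

/-- The quadratic form of the Hessian is that of the derivative of the gradient. -/
lemma dotProduct_hessian_mulVec (x v : EuclideanSpace ℝ (Fin d)) :
    v ⬝ᵥ hessian f x *ᵥ v = inner ℝ (fderiv ℝ (gradient f) x v) v := by
  rw [← inner_toEuclideanCLM, toEuclideanCLM_hessian, real_inner_comm]

lemma HasLipschitzHessian.norm_gradient_sub_le (h : HasLipschitzHessian γ f) (hγ : 0 ≤ γ)
    (z w : EuclideanSpace ℝ (Fin d)) :
    ‖gradient f (z + w) - gradient f z - fderiv ℝ (gradient f) z w‖ ≤ γ * ‖w‖ ^ 2 := by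
  have h1 : ∀ y ∈ Metric.closedBall z ‖w‖, HasFDerivWithinAt
      (fun y => gradient f y - fderiv ℝ (gradient f) z y)
      (fderiv ℝ (gradient f) y - fderiv ℝ (gradient f) z) (Metric.closedBall z ‖w‖) y := fun y _ =>
    ((h.2.1 y).hasFDerivAt.sub (fderiv ℝ (gradient f) z).hasFDerivAt).hasFDerivWithinAt
  have h2 := (convex_closedBall z ‖w‖).norm_image_sub_le_of_norm_hasFDerivWithin_le h1
    (fun y hy => (h.norm_sub_le y z).trans
      (mul_le_mul_of_nonneg_left (by simpa [dist_eq_norm] using hy) hγ))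
    (Metric.mem_closedBall_self (norm_nonneg w)) (y := z + w) (by simp)
  rw [add_sub_cancel_left] at h2
  convert h2 using 1
  · rw [map_add]; congr 1; abel
  · ring

/-- Mean value inequality for the remainder, whose gradient is controlled by `norm_gradient_sub_le`.
The constant is not sharp; only the cubic order is used. -/
lemma HasLipschitzHessian.abs_sub_taylor_le (h : HasLipschitzHessian γ f) (hγ : 0 ≤ γ)
    (z w : EuclideanSpace ℝ (Fin d)) :
    |f (z + w) - f z - inner ℝ (gradient f z) w
      - 1 / 2 * inner ℝ w (fderiv ℝ (gradient f) z w)| ≤ γ * ‖w‖ ^ 3 := by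
  set T := fderiv ℝ (gradient f) z with hT
  have h1 : ∀ u ∈ Metric.closedBall (0 : EuclideanSpace ℝ (Fin d)) ‖w‖, HasFDerivWithinAt
      (fun u => f (z + u) - inner ℝ (gradient f z) u - 1 / 2 * inner ℝ u (T u))
      (innerSL ℝ (gradient f (z + u) - gradient f z - T u))
      (Metric.closedBall 0 ‖w‖) u := fun u _ => by
    have e1 : HasFDerivAt (fun u => f (z + u)) (innerSL ℝ (gradient f (z + u))) u :=
      (hasFDerivAt_comp_add_left z).2 (h.hasFDerivAt (z + u))
    have e2 : HasFDerivAt (fun u => inner ℝ (gradient f z) u) (innerSL ℝ (gradient f z)) u :=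
      (innerSL ℝ (gradient f z)).hasFDerivAt
    have e3 := ((hasFDerivAt_id u).inner ℝ T.hasFDerivAt).const_mul (1 / 2 : ℝ)
    refine (((e1.sub e2).sub e3).congr_fderiv ?_).hasFDerivWithinAt
    ext v
    -- Symmetry of the Hessian makes `T u` the gradient of `½⟪u, T u⟫`.
    have := h.inner_symm z u v
    rw [← hT] at this
    have hc := real_inner_comm (T u) v
    simp
    linarith
  have h2 := (convex_closedBall (0 : EuclideanSpace ℝ (Fin d))
      ‖w‖).norm_image_sub_le_of_norm_hasFDerivWithin_le (C := γ * ‖w‖ ^ 2) h1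
    (fun u hu => by
      rw [innerSL_apply_norm]
      refine (h.norm_gradient_sub_le hγ z u).trans (mul_le_mul_of_nonneg_left ?_ hγ)
      exact pow_le_pow_left₀ (norm_nonneg u) (by simpa using hu) 2)
    (Metric.mem_closedBall_self (norm_nonneg w)) (y := w) (by simp)
  rw [Real.norm_eq_abs] at h2
  convert h2 using 1
  · congr 1; simp; ring
  · simp; ring

/-- Mean value inequality once more; `|L|` appears because no sign of `L` is assumed. -/
lemma IsLSmooth.sub_le (h : IsLSmooth L f) (z w : EuclideanSpace ℝ (Fin d)) :
    |f (z + w) - f z - inner ℝ (gradient f z) w| ≤ |L| * ‖w‖ ^ 2 := by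
  have h1 : ∀ u ∈ Metric.closedBall (0 : EuclideanSpace ℝ (Fin d)) ‖w‖, HasFDerivWithinAt
      (fun u => f (z + u) - inner ℝ (gradient f z) u)
      (innerSL ℝ (gradient f (z + u) - gradient f z))
      (Metric.closedBall 0 ‖w‖) u := fun u _ => by
    have e1 : HasFDerivAt (fun u => f (z + u)) (innerSL ℝ (gradient f (z + u))) u :=
      (hasFDerivAt_comp_add_left z).2 (h.1 (z + u)).hasGradientAt.hasFDerivAt
    have e2 : HasFDerivAt (fun u => inner ℝ (gradient f z) u) (innerSL ℝ (gradient f z)) u :=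
      (innerSL ℝ (gradient f z)).hasFDerivAt
    refine ((e1.sub e2).congr_fderiv ?_).hasFDerivWithinAt
    rw [map_sub]
  have h2 := (convex_closedBall (0 : EuclideanSpace ℝ (Fin d))
      ‖w‖).norm_image_sub_le_of_norm_hasFDerivWithin_le (C := |L| * ‖w‖) h1
    (fun u hu => by
      rw [innerSL_apply_norm]
      refine (h.2 (z + u) z).trans ?_
      rw [add_sub_cancel_left]
      exact mul_le_mul (le_abs_self L) (by simpa using hu) (norm_nonneg u) (abs_nonneg L))
    (Metric.mem_closedBall_self (norm_nonneg w)) (y := w) (by simp)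
  rw [Real.norm_eq_abs] at h2
  convert h2 using 1
  · congr 1; simp; ring
  · simp; ring

end Taylor

end RegularizedES

namespace RegularizedES

open MeasureTheory ProbabilityTheory Matrix

/-- The expectation of the Hessian of `f` under the normal distribution `N(μ, S)`. -/
noncomputable def meanHessian {d : ℕ} (f : EuclideanSpace ℝ (Fin d) → ℝ) (μ : EuclideanSpace ℝ (Fin d))
    (S : Matrix (Fin d) (Fin d) ℝ) : Matrix (Fin d) (Fin d) ℝ :=
  Matrix.of fun i j => ∫ x, hessian f (μ + x) i j ∂multivariateGaussian 0 S

/-! ### The expected Hessian: distance to the Hessian at the mean, and lower bound. -/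

section MeanHessian

variable {d : ℕ} {f : EuclideanSpace ℝ (Fin d) → ℝ} {L σ γ : ℝ}
  {μ : EuclideanSpace ℝ (Fin d)} {A B M : Matrix (Fin d) (Fin d) ℝ}

/-- The variance of `‖x‖` is nonnegative and its second moment is the trace. -/
lemma integral_norm_le_sqrt_trace (hA : A.PosSemidef) :
    ∫ x, ‖x‖ ∂multivariateGaussian 0 A ≤ Real.sqrt A.trace := by
  have h1 := integrable_norm_pow_of_isGaussian (multivariateGaussian 0 A) 1
  have h2 := integrable_norm_pow_of_isGaussian (multivariateGaussian 0 A) 2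
  simp only [pow_one] at h1
  set m := ∫ x, ‖x‖ ∂multivariateGaussian 0 A with hm
  refine Real.le_sqrt_of_sq_le ?_
  have h3 : 0 ≤ ∫ x, (‖x‖ - m) ^ 2 ∂multivariateGaussian 0 A :=
    integral_nonneg fun x => sq_nonneg _
  have h4 : ∀ x : EuclideanSpace ℝ (Fin d),
      (‖x‖ - m) ^ 2 = ‖x‖ ^ 2 - (2 * m) * ‖x‖ + m ^ 2 := fun x => by ring
  simp_rw [h4] at h3
  have h5 : Integrable (fun x => ‖x‖ ^ 2 - (2 * m) * ‖x‖) (multivariateGaussian 0 A) :=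
    h2.sub (h1.const_mul _)
  rw [integral_add h5 (integrable_const _), integral_sub h2 (h1.const_mul _), integral_const_mul, integral_norm_sq hA, ← hm] at h3
  simp at h3
  nlinarith

lemma HasLipschitzHessian.frobNorm_hessian_sub_le (h : HasLipschitzHessian γ f) (hγ : 0 ≤ γ)
    (x y : EuclideanSpace ℝ (Fin d)) :
    frobNorm (hessian f x - hessian f y) ≤ Real.sqrt d * (γ * ‖x - y‖) := by
  refine frobNorm_le_sqrt_mul (by positivity) fun v => ?_
  exact (ContinuousLinearMap.le_opNorm _ v).trans
    (mul_le_mul_of_nonneg_right (h.2.2 x y) (norm_nonneg v))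

lemma HasLipschitzHessian.abs_hessian_apply_sub_le (h : HasLipschitzHessian γ f)
    (x y : EuclideanSpace ℝ (Fin d)) (i j : Fin d) :
    |hessian f x i j - hessian f y i j| ≤ γ * ‖x - y‖ := by
  rw [hessian_apply, hessian_apply, ← PiLp.sub_apply, ← _root_.sub_apply, ← Real.norm_eq_abs]
  refine (PiLp.norm_apply_le _ i).trans ((ContinuousLinearMap.le_opNorm _ _).trans ?_)
  simpa using h.norm_sub_le x y

lemma HasLipschitzHessian.continuous_hessian_apply (h : HasLipschitzHessian γ f) (hγ : 0 ≤ γ)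
    (i j : Fin d) : Continuous fun x => hessian f x i j := by
  refine (LipschitzWith.of_dist_le_mul (K := ⟨γ, hγ⟩) fun x y => ?_).continuous
  rw [Real.dist_eq, dist_eq_norm]
  exact h.abs_hessian_apply_sub_le x y i j

lemma HasLipschitzHessian.integrable_hessian_apply (h : HasLipschitzHessian γ f) (hγ : 0 ≤ γ)
    (ν : Measure (EuclideanSpace ℝ (Fin d))) [IsGaussian ν] (c : ℝ) (i j : Fin d) :
    Integrable (fun x => hessian f (μ + c • x) i j) ν := by
  refine integrable_of_cubic_growth ν
    ((h.continuous_hessian_apply hγ i j).comp (by fun_prop : Continuous fun x => μ + c • x))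
    (a := |hessian f μ i j|) (b := γ * |c|) (c := 0) (e := 0) fun x => ?_
  have h1 := h.abs_hessian_apply_sub_le (μ + c • x) μ i j
  rw [add_sub_cancel_left, norm_smul, Real.norm_eq_abs] at h1
  have h2 := abs_sub_abs_le_abs_sub (hessian f (μ + c • x) i j) (hessian f μ i j)
  rw [Real.norm_eq_abs]
  linarith

lemma HasLipschitzHessian.integrable_frobInner (h : HasLipschitzHessian γ f) (hγ : 0 ≤ γ)
    (ν : Measure (EuclideanSpace ℝ (Fin d))) [IsGaussian ν] (c : ℝ) :
    Integrable (fun x => frobInner (hessian f (μ + c • x)) M) ν :=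
  integrable_finsetSum _ fun i _ => integrable_finsetSum _ fun j _ =>
    (h.integrable_hessian_apply hγ ν c i j).mul_const (M i j)

lemma HasLipschitzHessian.integral_frobInner (h : HasLipschitzHessian γ f) (hγ : 0 ≤ γ) :
    ∫ x, frobInner (hessian f (μ + x)) M ∂multivariateGaussian 0 A
      = frobInner (meanHessian f μ A) M := by
  have hI : ∀ i j, Integrable (fun x => hessian f (μ + x) i j * M i j)
      (multivariateGaussian 0 A) := fun i j => by
    simpa using (h.integrable_hessian_apply (μ := μ) hγ (multivariateGaussian 0 A) 1 i j).mul_const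
      (M i j)
  refine (integral_finsetSum _ fun i _ => integrable_finsetSum _ fun j _ => hI i j).trans
    (Finset.sum_congr rfl fun i _ => ?_)
  refine (integral_finsetSum _ fun j _ => hI i j).trans (Finset.sum_congr rfl fun j _ => ?_)
  exact integral_mul_const (M i j) _

/-- Pairing the difference `M` with itself gives `‖M‖² = ∫ ⟪H(μ + x) - H(μ), M⟫`, a scalar integral
to which Cauchy–Schwarz applies pointwise; then divide by `‖M‖`. -/
lemma HasLipschitzHessian.frobNorm_meanHessian_sub_le (h : HasLipschitzHessian γ f) (hγ : 0 ≤ γ)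
    (hA : A.PosSemidef) :
    frobNorm (meanHessian f μ A - hessian f μ) ≤ Real.sqrt d * γ * Real.sqrt A.trace := by
  set M := meanHessian f μ A - hessian f μ with hM
  have hI : Integrable (fun x => frobInner (hessian f (μ + x)) M) (multivariateGaussian 0 A) := by
    simpa using h.integrable_frobInner (μ := μ) (M := M) hγ (multivariateGaussian 0 A) 1
  have hN := integrable_norm_pow_of_isGaussian (multivariateGaussian 0 A) 1
  simp only [pow_one] at hN
  have h1 : frobNorm M ^ 2
      = ∫ x, (frobInner (hessian f (μ + x)) M - frobInner (hessian f μ) M)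
        ∂multivariateGaussian 0 A := by
    rw [integral_sub hI (integrable_const _), h.integral_frobInner hγ, ← frobInner_self]
    conv_lhs => rw [hM, frobInner_sub_left, ← hM]
    simp
  have h2 : frobNorm M ^ 2 ≤ Real.sqrt d * γ * frobNorm M * Real.sqrt A.trace := by
    rw [h1]
    calc _ ≤ ∫ x, Real.sqrt d * γ * frobNorm M * ‖x‖ ∂multivariateGaussian 0 A := by
          refine integral_mono (hI.sub (integrable_const _)) (hN.const_mul _) fun x => ?_
          simp only [← frobInner_sub_left]
          refine ((le_abs_self _).trans (abs_frobInner_le _ _)).trans ?_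
          refine (mul_le_mul_of_nonneg_right (h.frobNorm_hessian_sub_le hγ _ _)
            (frobNorm_nonneg _)).trans_eq ?_
          rw [add_sub_cancel_left]
          ring
      _ ≤ _ := by
          rw [integral_const_mul]
          exact mul_le_mul_of_nonneg_left (integral_norm_le_sqrt_trace hA)
            (mul_nonneg (by positivity) (frobNorm_nonneg _))
  rcases (frobNorm_nonneg M).eq_or_lt with h0 | h0
  · rw [← h0]; positivity
  · exact le_of_mul_le_mul_right (by linarith) h0

/-- Makes quadratic forms Frobenius pairings, so that they commute with the expectation. -/
lemma frobInner_vecMulVec (v : Fin d → ℝ) : frobInner A (vecMulVec v v) = v ⬝ᵥ A *ᵥ v := by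
  simp only [frobInner, vecMulVec_apply, dotProduct, mulVec, Finset.mul_sum]
  exact Finset.sum_congr rfl fun i _ => Finset.sum_congr rfl fun j _ => by ring

lemma posSemidef_sub_smul_one_iff {H : Matrix (Fin d) (Fin d) ℝ} (hH : Hᵀ = H) :
    (H - σ • (1 : Matrix (Fin d) (Fin d) ℝ)).PosSemidef ↔
      ∀ v : EuclideanSpace ℝ (Fin d), σ * ‖v‖ ^ 2 ≤ v ⬝ᵥ H *ᵥ v := by
  have key : ∀ v : Fin d → ℝ, v ⬝ᵥ (H - σ • (1 : Matrix (Fin d) (Fin d) ℝ)) *ᵥ v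
      = v ⬝ᵥ H *ᵥ v - σ * ‖(WithLp.toLp 2 v : EuclideanSpace ℝ (Fin d))‖ ^ 2 := fun v => by
    rw [sub_mulVec, dotProduct_sub, smul_mulVec, one_mulVec, dotProduct_smul, smul_eq_mul,
      EuclideanSpace.real_norm_sq_eq]
    simp [dotProduct, sq]
  rw [posSemidef_real_iff, transpose_sub, hH, transpose_smul, transpose_one]
  simp only [true_and, key, sub_nonneg]
  exact ⟨fun h v => h v, fun h v => h (WithLp.toLp 2 v)⟩

lemma HasLipschitzHessian.posSemidef_hessian_sub (h : HasLipschitzHessian γ f)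
    (hc : IsStronglyConvex σ f) (x : EuclideanSpace ℝ (Fin d)) :
    (hessian f x - σ • (1 : Matrix (Fin d) (Fin d) ℝ)).PosSemidef := by
  rw [posSemidef_sub_smul_one_iff (h.transpose_hessian x)]
  intro v
  rw [dotProduct_hessian_mulVec]
  exact hc.mul_norm_sq_le_inner_fderiv h.2.1 x v

lemma HasLipschitzHessian.posSemidef_meanHessian_sub (h : HasLipschitzHessian γ f) (hγ : 0 ≤ γ)
    (hc : IsStronglyConvex σ f) :
    (meanHessian f μ A - σ • (1 : Matrix (Fin d) (Fin d) ℝ)).PosSemidef := by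
  have ht : (meanHessian f μ A)ᵀ = meanHessian f μ A := by
    ext i j
    simp only [meanHessian, transpose_apply, of_apply]
    refine integral_congr_ae (Filter.Eventually.of_forall fun x => ?_)
    exact congrFun (congrFun (h.transpose_hessian (μ + x)) i) j
  rw [posSemidef_sub_smul_one_iff ht]
  intro v
  rw [← frobInner_vecMulVec, ← h.integral_frobInner hγ]
  have hI : Integrable (fun x => frobInner (hessian f (μ + x)) (vecMulVec v v))
      (multivariateGaussian 0 A) := by
    simpa using h.integrable_frobInner (μ := μ) (M := vecMulVec v v) hγ
      (multivariateGaussian 0 A) 1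
  have h1 := integral_mono (integrable_const (σ * ‖v‖ ^ 2)) hI fun x => by
    simp only [frobInner_vecMulVec]
    exact (posSemidef_sub_smul_one_iff (h.transpose_hessian _)).1
      (h.posSemidef_hessian_sub hc (μ + x)) v
  simpa using h1

end MeanHessian

/-! ### Expansion of the Gaussian smoothing in the covariance. -/

section FirstOrder

variable {d : ℕ} {f : EuclideanSpace ℝ (Fin d) → ℝ} {L σ γ α τ ζ : ℝ}
  {μ : EuclideanSpace ℝ (Fin d)} {A B M : Matrix (Fin d) (Fin d) ℝ}

lemma IsLSmooth.integrable_comp (h : IsLSmooth L f) (ν : Measure (EuclideanSpace ℝ (Fin d)))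
    [IsGaussian ν] (c : ℝ) : Integrable (fun x => f (μ + c • x)) ν := by
  refine integrable_of_cubic_growth ν
    (h.1.continuous.comp (by fun_prop : Continuous fun x => μ + c • x))
    (a := |f μ|) (b := |c| * ‖gradient f μ‖) (c := |L| * |c| ^ 2) (e := 0) fun x => ?_
  have h1 := abs_le.1 (h.sub_le μ (c • x))
  have h2 := abs_le.1 (abs_real_inner_le_norm (gradient f μ) (c • x))
  rw [norm_smul, Real.norm_eq_abs] at h1 h2
  rw [Real.norm_eq_abs, abs_le]
  have h3 := neg_abs_le (f μ)
  have h4 := le_abs_self (f μ)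
  constructor
  · nlinarith
  · nlinarith

/-- Second-order expansion of the Gaussian smoothing in the covariance. -/
lemma abs_gaussian_expansion_le (hL : IsLSmooth L f) (h : HasLipschitzHessian γ f) (hγ : 0 ≤ γ)
    (hA : A.PosSemidef) (hB : B.PosSemidef) (a : ℝ) {b : ℝ} (hb : 0 ≤ b) :
    |∫ z, f z ∂multivariateGaussian μ (a ^ 2 • A + b ^ 2 • B)
      - (∫ x, f (μ + a • x) ∂multivariateGaussian 0 A
        + b ^ 2 / 2 * ∫ x, frobInner (hessian f (μ + a • x)) B ∂multivariateGaussian 0 A)|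
      ≤ b ^ 3 * (γ * ∫ y, ‖y‖ ^ 3 ∂multivariateGaussian 0 B) := by
  have hm : Measurable fun p : EuclideanSpace ℝ (Fin d) × EuclideanSpace ℝ (Fin d) =>
      μ + (a • p.1 + b • p.2) := by fun_prop
  have hint : Integrable (fun p : EuclideanSpace ℝ (Fin d) × EuclideanSpace ℝ (Fin d) =>
      f (μ + (a • p.1 + b • p.2)))
      ((multivariateGaussian 0 A).prod (multivariateGaussian 0 B)) := by
    have h1 := hL.integrable_comp (μ := 0) (multivariateGaussian μ (a ^ 2 • A + b ^ 2 • B)) 1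
    simp only [zero_add, one_smul] at h1
    rw [← map_prod_multivariateGaussian hA hB,
      integrable_map_measure hL.1.continuous.aestronglyMeasurable hm.aemeasurable] at h1
    exact h1
  have hs : Integrable (fun x => f (μ + a • x) + b ^ 2 / 2 * frobInner (hessian f (μ + a • x)) B)
      (multivariateGaussian 0 A) :=
    (hL.integrable_comp _ a).add ((h.integrable_frobInner hγ _ a).const_mul _)
  rw [← map_prod_multivariateGaussian hA hB,
    integral_map hm.aemeasurable hL.1.continuous.aestronglyMeasurable, integral_prod _ hint,
    ← integral_const_mul, ← integral_add (hL.integrable_comp _ a)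
      ((h.integrable_frobInner hγ _ a).const_mul _),
    ← integral_sub hint.integral_prod_left hs, ← Real.norm_eq_abs]
  refine (norm_integral_le_of_norm_le_const (C := b ^ 3 * (γ * ∫ y, ‖y‖ ^ 3 ∂multivariateGaussian 0 B))
    (Filter.Eventually.of_forall fun x => ?_)).trans_eq (by simp)
  -- With `x` fixed, `f` is expanded around `z` in the independent increment `b • y`.
  set z := μ + a • x with hz
  set T := fderiv ℝ (gradient f) z with hT
  have hq : Integrable (fun y => inner ℝ y (T y)) (multivariateGaussian 0 B) := by
    refine integrable_of_cubic_growth _ (by fun_prop) (a := 0) (b := 0) (c := ‖T‖) (e := 0)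
      fun y => ?_
    have h1 := (norm_inner_le_norm (𝕜 := ℝ) y (T y)).trans
      (mul_le_mul_of_nonneg_left (T.le_opNorm y) (norm_nonneg y))
    linarith
  have hl : Integrable (fun y => inner ℝ (gradient f z) y) (multivariateGaussian 0 B) :=
    IsGaussian.integrable_fun_id.const_inner _
  have hf : Integrable (fun y => f (z + b • y)) (multivariateGaussian 0 B) :=
    hL.integrable_comp _ b
  have hqi : ∫ y, inner ℝ y (T y) ∂multivariateGaussian 0 B = frobInner (hessian f z) B := by
    rw [← integral_quadratic hB, toEuclideanCLM_hessian]
  have hfc : Integrable (fun y => f (z + b • y) - f z) (multivariateGaussian 0 B) :=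
    hf.sub (integrable_const _)
  have hfl : Integrable (fun y => f (z + b • y) - f z - b * inner ℝ (gradient f z) y)
      (multivariateGaussian 0 B) := hfc.sub (hl.const_mul _)
  -- The linear term has mean zero and the quadratic term has mean `⟪H(z), B⟫`, so only the Taylor
  -- remainder is left.
  have e1 : ∫ y, f (μ + (a • x + b • y)) ∂multivariateGaussian 0 B
      - (f z + b ^ 2 / 2 * frobInner (hessian f z) B)
      = ∫ y, (f (z + b • y) - f z - b * inner ℝ (gradient f z) y
          - b ^ 2 / 2 * inner ℝ y (T y)) ∂multivariateGaussian 0 B := by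
    rw [integral_sub hfl (hq.const_mul _), integral_sub hfc (hl.const_mul _),
      integral_sub hf (integrable_const _), integral_const_mul, integral_const_mul, hqi,
      integral_inner_multivariateGaussian]
    simp only [hz, add_assoc, integral_const, probReal_univ, one_smul, mul_zero]
    ring
  rw [e1, ← integral_const_mul, ← integral_const_mul]
  refine norm_integral_le_of_norm_le
    (((integrable_norm_pow_of_isGaussian _ 3).const_mul _).const_mul _)
    (Filter.Eventually.of_forall fun y => ?_)
  have h1 := h.abs_sub_taylor_le hγ z (b • y)
  rw [← hT, map_smul, real_inner_smul_left, real_inner_smul_right, real_inner_smul_right, norm_smul,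
    Real.norm_of_nonneg hb] at h1
  rw [Real.norm_eq_abs]
  convert h1 using 1
  · congr 1; ring
  · ring

end FirstOrder

end RegularizedES

namespace RegularizedES

open MeasureTheory ProbabilityTheory Matrix

/-! ### First-order conditions in the covariance and in the mean. -/

section Optimality

variable {d : ℕ} {f : EuclideanSpace ℝ (Fin d) → ℝ} {L σ γ α τ ζ : ℝ}
  {μ : EuclideanSpace ℝ (Fin d)} {A B P S : Matrix (Fin d) (Fin d) ℝ}

lemma abs_integral_frobInner_sub_le (h : HasLipschitzHessian γ f) (hγ : 0 ≤ γ) {c s : ℝ}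
    (hs : |c - 1| ≤ s) :
    |∫ x, frobInner (hessian f (μ + c • x)) B ∂multivariateGaussian 0 A
      - frobInner (meanHessian f μ A) B|
      ≤ s * (Real.sqrt d * γ * frobNorm B * ∫ x, ‖x‖ ∂multivariateGaussian 0 A) := by
  have hI := h.integrable_frobInner (μ := μ) (M := B) hγ (multivariateGaussian 0 A) c
  have hI1 : Integrable (fun x => frobInner (hessian f (μ + x)) B) (multivariateGaussian 0 A) := by
    simpa using h.integrable_frobInner (μ := μ) (M := B) hγ (multivariateGaussian 0 A) 1
  have hN := integrable_norm_pow_of_isGaussian (multivariateGaussian 0 A) 1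
  simp only [pow_one] at hN
  rw [← h.integral_frobInner hγ, ← integral_sub hI hI1, ← integral_const_mul, ← integral_const_mul,
    ← Real.norm_eq_abs]
  refine norm_integral_le_of_norm_le ((hN.const_mul _).const_mul _)
    (Filter.Eventually.of_forall fun x => ?_)
  rw [← frobInner_sub_left, Real.norm_eq_abs]
  refine (abs_frobInner_le _ _).trans ?_
  refine (mul_le_mul_of_nonneg_right (h.frobNorm_hessian_sub_le hγ _ _)
    (frobNorm_nonneg B)).trans ?_
  have h1 : ‖μ + c • x - (μ + x)‖ ≤ s * ‖x‖ := by
    have : μ + c • x - (μ + x) = (c - 1) • x := by module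
    rw [this, norm_smul, Real.norm_eq_abs]
    exact mul_le_mul_of_nonneg_right hs (norm_nonneg x)
  calc Real.sqrt d * (γ * ‖μ + c • x - (μ + x)‖) * frobNorm B
      ≤ Real.sqrt d * (γ * (s * ‖x‖)) * frobNorm B := by
        refine mul_le_mul_of_nonneg_right ?_ (frobNorm_nonneg B)
        gcongr
    _ = _ := by ring

/-- Along a segment of covariances the Gaussian smoothing has the expected Hessian as derivative. -/
lemma exists_gaussian_sub_le (hL : IsLSmooth L f) (h : HasLipschitzHessian γ f) (hγ : 0 ≤ γ)
    (hA : A.PosSemidef) (hB : B.PosSemidef) :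
    ∃ C K : ℝ, ∀ s ∈ Set.Icc (0 : ℝ) 1,
      ∫ z, f z ∂multivariateGaussian μ (A + s ^ 2 • (B - A)) - ∫ z, f z ∂multivariateGaussian μ A
        ≤ s ^ 2 / 2 * (frobInner (meanHessian f μ A) (B - A) + s ^ 2 * C) + s ^ 3 * K := by
  refine ⟨Real.sqrt d * γ * frobNorm (B - A) * ∫ x, ‖x‖ ∂multivariateGaussian 0 A,
    γ * ∫ y, ‖y‖ ^ 3 ∂multivariateGaussian 0 B + γ * ∫ y, ‖y‖ ^ 3 ∂multivariateGaussian 0 A,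
    fun s hs => ?_⟩
  -- With `c² + s² = 1`, the combination `c²A + s²B` runs along the segment from `A` to `B`.
  set c := Real.sqrt (1 - s ^ 2) with hc
  have hs2 : s ^ 2 ≤ 1 := pow_le_one₀ hs.1 hs.2
  have hc2 : c ^ 2 = 1 - s ^ 2 := Real.sq_sqrt (by linarith)
  have hc0 : 0 ≤ c := Real.sqrt_nonneg _
  have hc1 : |c - 1| ≤ s ^ 2 := by
    have : c ≤ 1 := Real.sqrt_le_one.2 (by nlinarith [sq_nonneg s])
    rw [abs_of_nonpos (by linarith)]
    nlinarith
  have h1 := (abs_le.1 (abs_gaussian_expansion_le (μ := μ) hL h hγ hA hB c hs.1)).2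
  -- The same expansion with `B` replaced by `A` represents `N(μ, A)` itself; subtracting it cancels
  -- the common term `∫ f(μ + c x)`.
  have h2 := (abs_le.1 (abs_gaussian_expansion_le (μ := μ) hL h hγ hA hA c hs.1)).1
  have h3 := (abs_le.1 (abs_integral_frobInner_sub_le (μ := μ) (A := A) (B := B - A) h hγ hc1)).2
  have e1 : c ^ 2 • A + s ^ 2 • B = A + s ^ 2 • (B - A) := by rw [hc2]; module
  have e2 : c ^ 2 • A + s ^ 2 • A = A := by rw [hc2]; module
  rw [e1] at h1
  rw [e2] at h2
  simp only [frobInner_sub_right] at h3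
  rw [integral_sub (h.integrable_frobInner hγ _ c) (h.integrable_frobInner hγ _ c)] at h3
  have h4 := mul_le_mul_of_nonneg_left h3 (by positivity : 0 ≤ s ^ 2 / 2)
  rw [frobInner_sub_right]
  linarith

/-- The first-order condition in the covariance for a minimizer of the regularized objective. -/
lemma frobInner_meanHessian_sub_inv_nonneg (hτ : 0 < τ) (hτζ : τ ≤ ζ) (hα : 0 < α)
    (hL : IsLSmooth L f) (h : HasLipschitzHessian γ f) (hγ : 0 ≤ γ) (hP : P ∈ covSet d τ ζ)
    (hmin : ∀ S ∈ covSet d τ ζ, regQ f α μ P ≤ regQ f α μ S) (hS : S ∈ covSet d τ ζ) :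
    0 ≤ frobInner (meanHessian f μ (α ^ 2 • P) - P⁻¹) (S - P) := by
  have hζ := hτ.trans_le hτζ
  have hPp := posDef_of_mem_covSet hζ hP
  have hSp := posDef_of_mem_covSet hζ hS
  obtain ⟨C, K, hCK⟩ := exists_gaussian_sub_le (μ := μ) hL h hγ (hPp.posSemidef.smul (sq_nonneg α))
    (hSp.posSemidef.smul (sq_nonneg α))
  have hX : frobInner (meanHessian f μ (α ^ 2 • P)) (α ^ 2 • S - α ^ 2 • P)
      = α ^ 2 * frobInner (meanHessian f μ (α ^ 2 • P)) (S - P) := by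
    rw [← smul_sub, frobInner_comm, frobInner_comm _ (S - P)]
    simp [frobInner, Finset.mul_sum, mul_assoc]
  rw [hX] at hCK
  set X := frobInner (meanHessian f μ (α ^ 2 • P)) (S - P)
  have hld := (hasDerivAt_log_det hPp (S - P)).tendsto_slope_zero_right
  simp only [zero_add, zero_smul, add_zero, smul_eq_mul] at hld
  -- Upper bound for the difference quotient of the objective along `P + t(S - P)`, with `s = √t`;
  -- the cubic remainder `s³` becomes `√t` after division by `t`.
  have hlim : Filter.Tendsto (fun t : ℝ => 1 / 2 * (α ^ 2 * X + t * C) + Real.sqrt t * K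
      - α ^ 2 / 2 * (t⁻¹ * (Real.log (P + t • (S - P)).det - Real.log P.det)))
      (nhdsWithin 0 (Set.Ioi 0))
      (nhds (1 / 2 * (α ^ 2 * X + 0 * C) + Real.sqrt 0 * K - α ^ 2 / 2 * frobInner P⁻¹ (S - P))) := by
    refine Filter.Tendsto.sub ?_ (hld.const_mul _)
    exact (Continuous.tendsto (by fun_prop : Continuous fun t : ℝ =>
      1 / 2 * (α ^ 2 * X + t * C) + Real.sqrt t * K) 0).mono_left nhdsWithin_le_nhds
  have hnn := ge_of_tendsto (b := 0) hlim (by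
    filter_upwards [Ioo_mem_nhdsGT (zero_lt_one' ℝ)] with t ht
    have hst : Real.sqrt t ^ 2 = t := Real.sq_sqrt ht.1.le
    have hmem : P + t • (S - P) ∈ covSet d τ ζ := by
      have := covSet_combo (a := 1 - t) (b := t) (by linarith [ht.2]) ht.1.le (by ring) hP hS
      convert this using 1
      module
    have h1 := hmin _ hmem
    have h2 := hCK (Real.sqrt t) ⟨Real.sqrt_nonneg t, Real.sqrt_le_one.2 ht.2.le⟩
    have e1 : α ^ 2 • P + t • (α ^ 2 • S - α ^ 2 • P) = α ^ 2 • (P + t • (S - P)) := by module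
    have e2 : Real.sqrt t ^ 3 = t * Real.sqrt t := by rw [pow_succ, hst]
    rw [hst, e2, e1] at h2
    simp only [regQ, gaussJ] at h1
    have h3 : 0 ≤ t * (1 / 2 * (α ^ 2 * X + t * C) + Real.sqrt t * K)
        - α ^ 2 / 2 * (Real.log (P + t • (S - P)).det - Real.log P.det) := by linarith
    have h4 := mul_nonneg (inv_nonneg.2 ht.1.le) h3
    convert h4 using 1
    have := ht.1.ne'
    field_simp)
  rw [frobInner_sub_left]
  have hα2 : 0 < α ^ 2 := by positivity
  simp only [zero_mul, add_zero, Real.sqrt_zero] at hnn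
  nlinarith

/-- At a minimizer of the Gaussian smoothing in the mean, the gradient is small. -/
lemma norm_gradient_le_of_isMin (hL : IsLSmooth L f) (h : HasLipschitzHessian γ f) (hγ : 0 ≤ γ)
    (hA : A.PosSemidef)
    (hmin : ∀ ν, ∫ z, f z ∂multivariateGaussian μ A ≤ ∫ z, f z ∂multivariateGaussian ν A) :
    ‖gradient f μ‖ ≤ γ * A.trace := by
  set g := gradient f μ with hg
  set T := fderiv ℝ (gradient f) μ with hT
  have hN := integrable_norm_pow_of_isGaussian (multivariateGaussian 0 A) 2
  have hf : ∀ ν, Integrable (fun x => f (ν + x)) (multivariateGaussian 0 A) := fun ν => by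
    simpa using hL.integrable_comp (μ := ν) (multivariateGaussian 0 A) 1
  have hl : Integrable (fun x => inner ℝ (T g) x) (multivariateGaussian 0 A) :=
    IsGaussian.integrable_fun_id.const_inner _
  have key : ∀ s : ℝ, 0 < s → ‖g‖ ^ 2 - γ * A.trace * ‖g‖ ≤ s * (|L| * ‖g‖ ^ 2) := fun s hs => by
    -- Tests optimality with the shift `-s g`: smoothness bounds the decrease at `μ + x`, and the
    -- gradient there is expanded around `μ`. The term linear in `x` integrates to zero.
    have hpt : ∀ x, f ((μ - s • g) + x) ≤ f (μ + x) + ((s * (γ * ‖g‖)) * ‖x‖ ^ 2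
        + ((-s) * inner ℝ (T g) x + (|L| * (s ^ 2 * ‖g‖ ^ 2) - s * ‖g‖ ^ 2))) := fun x => by
      have h1 := (abs_le.1 (hL.sub_le (μ + x) (-(s • g)))).2
      have h2 := h.norm_gradient_sub_le hγ μ x
      have h3 := (abs_le.1 ((abs_real_inner_le_norm (gradient f (μ + x) - g - T x) g).trans
        (mul_le_mul_of_nonneg_right h2 (norm_nonneg g)))).1
      have h4 := h.inner_symm μ x g
      rw [← hT] at h4
      rw [inner_sub_left, inner_sub_left, h4, real_inner_self_eq_norm_sq, real_inner_comm] at h3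
      rw [inner_neg_right, real_inner_smul_right, norm_neg, norm_smul, mul_pow, Real.norm_eq_abs,
        sq_abs] at h1
      have e : μ + x + -(s • g) = μ - s • g + x := by abel
      rw [e] at h1
      have h5 := mul_le_mul_of_nonneg_left h3 hs.le
      have h6 := real_inner_comm (gradient f (μ + x)) g
      have h7 := real_inner_comm x (T g)
      nlinarith
    have hr : Integrable (fun x => (-s) * inner ℝ (T g) x + (|L| * (s ^ 2 * ‖g‖ ^ 2) - s * ‖g‖ ^ 2))
        (multivariateGaussian 0 A) := (hl.const_mul _).add (integrable_const _)
    have hr2 : Integrable (fun x => (s * (γ * ‖g‖)) * ‖x‖ ^ 2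
        + ((-s) * inner ℝ (T g) x + (|L| * (s ^ 2 * ‖g‖ ^ 2) - s * ‖g‖ ^ 2)))
        (multivariateGaussian 0 A) := (hN.const_mul _).add hr
    have h1 := (hmin (μ - s • g)).trans_eq (integral_multivariateGaussian_eq hL.1.continuous)
    have h2 := integral_mono (hf (μ - s • g)) ((hf μ).add hr2) hpt
    have h3 := h1.trans h2
    rw [integral_multivariateGaussian_eq hL.1.continuous] at h3
    simp only [Pi.add_apply] at h3
    rw [integral_add (hf μ) hr2, integral_add (hN.const_mul _) hr,
      integral_add (hl.const_mul _) (integrable_const _), integral_const_mul, integral_const_mul,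
      integral_norm_sq hA, integral_inner_multivariateGaussian] at h3
    simp only [integral_const, probReal_univ, one_smul, mul_zero] at h3
    refine le_of_mul_le_mul_left (a := s) ?_ hs
    linarith
  have h0 : ‖g‖ ^ 2 - γ * A.trace * ‖g‖ ≤ 0 := by
    refine ge_of_tendsto (x := nhdsWithin (0 : ℝ) (Set.Ioi 0))
      (f := fun s : ℝ => s * (|L| * ‖g‖ ^ 2)) ?_ (by
        filter_upwards [self_mem_nhdsWithin] with s hs using key s hs)
    have : Continuous fun s : ℝ => s * (|L| * ‖g‖ ^ 2) := by fun_prop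
    simpa using (this.tendsto 0).mono_left (nhdsWithin_le_nhds (s := Set.Ioi 0))
  rcases (norm_nonneg g).eq_or_lt with hg0 | hg0
  · rw [← hg0]; exact mul_nonneg hγ hA.trace_nonneg
  · nlinarith

end Optimality

end RegularizedES

namespace RegularizedES

open MeasureTheory ProbabilityTheory Matrix

/-! ### The dimensional factor and assembly of the bounds. -/

section Main

variable {d : ℕ} {f : EuclideanSpace ℝ (Fin d) → ℝ} {L σ γ α τ ζ : ℝ}
  {μ : EuclideanSpace ℝ (Fin d)} {P S : Matrix (Fin d) (Fin d) ℝ}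

/-- The first summand contributes `4 d^(3/2)` and the second `d^(3/2)`. Raising to the powers `6`
and `4` clears the fractional exponents. -/
lemma mul_sqrt_le_dimFactor (d : ℕ) : 5 * (d * Real.sqrt d) ≤ dimFactor d := by
  rcases Nat.eq_zero_or_pos d with rfl | hd
  · simp [dimFactor]
  have hd1 : (1 : ℝ) ≤ d := by exact_mod_cast hd
  have hx : Real.sqrt d ^ 2 = d := Real.sq_sqrt (by linarith)
  have hx0 : 0 ≤ Real.sqrt d := Real.sqrt_nonneg _
  set D : ℝ := (d : ℝ) with hD
  set x := Real.sqrt D with hxdef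
  have h1 : 4 * (D * x) ≤ (D ^ 3 + 6 * D ^ 2 + 8 * D) ^ (5 / 6 : ℝ) := by
    have hy : 0 ≤ D ^ 3 + 6 * D ^ 2 + 8 * D := by positivity
    refine (pow_le_pow_iff_left₀ (by positivity) (Real.rpow_nonneg hy _) (by norm_num : 6 ≠ 0)).1 ?_
    rw [← Real.rpow_natCast (_ ^ (5 / 6 : ℝ)), ← Real.rpow_mul hy]
    have e : (5 / 6 : ℝ) * ((6 : ℕ) : ℝ) = ((5 : ℕ) : ℝ) := by norm_num
    rw [e, Real.rpow_natCast]
    calc (4 * (D * x)) ^ 6 = 4096 * D ^ 6 * (x ^ 2) ^ 3 := by ring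
      _ = 4096 * D ^ 9 * 1 := by rw [hx]; ring
      -- `7776 = 6⁵`: only the middle term `6D²` of the cubic is kept, and `1 ≤ D` is used.
      _ ≤ 7776 * D ^ 9 * D := by gcongr; norm_num
      _ = (6 * D ^ 2) ^ 5 := by ring
      _ ≤ _ := by
          refine pow_le_pow_left₀ (by positivity) ?_ 5
          have : 0 ≤ D ^ 3 + 8 * D := by positivity
          linarith
  have h2 : x ≤ (D ^ 2 + 2 * D) ^ (3 / 4 : ℝ) := by
    have hy : 0 ≤ D ^ 2 + 2 * D := by positivity
    refine (pow_le_pow_iff_left₀ hx0 (Real.rpow_nonneg hy _) (by norm_num : 4 ≠ 0)).1 ?_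
    rw [← Real.rpow_natCast (_ ^ (3 / 4 : ℝ)), ← Real.rpow_mul hy]
    have e : (3 / 4 : ℝ) * ((4 : ℕ) : ℝ) = ((3 : ℕ) : ℝ) := by norm_num
    rw [e, Real.rpow_natCast]
    have h3 : (D ^ 2) ^ 1 ≤ (D ^ 2 + 2 * D) ^ 3 :=
      (pow_le_pow_left₀ (by positivity) (by linarith) 1).trans
        (pow_le_pow_right₀ (by nlinarith) (by norm_num))
    calc x ^ 4 = (x ^ 2) ^ 2 := by ring
      _ = (D ^ 2) ^ 1 := by rw [hx]; ring
      _ ≤ _ := h3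
  have h3 : D * x ≤ D * (D ^ 2 + 2 * D) ^ (3 / 4 : ℝ) :=
    mul_le_mul_of_nonneg_left h2 (by linarith)
  rw [dimFactor]
  linarith

lemma trace_smul_le_of_mem_covSet (hS : S ∈ covSet d τ ζ) :
    (α ^ 2 • S).trace ≤ α ^ 2 * (d / τ) := by
  rw [trace_smul, smul_eq_mul]
  exact mul_le_mul_of_nonneg_left (trace_le_of_mem_covSet hS) (sq_nonneg α)

lemma frobNorm_meanHessian_sub_hessian_le (hτ : 0 < τ) (hτζ : τ ≤ ζ) (hα : 0 < α)
    (h : HasLipschitzHessian γ f) (hγ : 0 ≤ γ) (hP : P ∈ covSet d τ ζ) :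
    frobNorm (meanHessian f μ (α ^ 2 • P) - hessian f μ) ≤ γ * α * d / Real.sqrt τ := by
  have hpsd := (posDef_of_mem_covSet (hτ.trans_le hτζ) hP).posSemidef
  refine (h.frobNorm_meanHessian_sub_le hγ (hpsd.smul (sq_nonneg α))).trans ?_
  calc Real.sqrt d * γ * Real.sqrt (α ^ 2 • P).trace
      ≤ Real.sqrt d * γ * Real.sqrt (α ^ 2 * (d / τ)) := by
        gcongr
        exact trace_smul_le_of_mem_covSet hP
    _ = γ * α * (Real.sqrt d * Real.sqrt d) / Real.sqrt τ := by
        rw [Real.sqrt_mul (sq_nonneg α), Real.sqrt_sq hα.le, Real.sqrt_div (Nat.cast_nonneg d)]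
        ring
    _ = _ := by rw [Real.mul_self_sqrt (Nat.cast_nonneg d)]

lemma eq_frobProj_inv_meanHessian (hσ : 0 < σ) (hτ : 0 < τ) (hτζ : τ ≤ ζ) (hα : 0 < α)
    (hL : IsLSmooth L f) (hc : IsStronglyConvex σ f) (h : HasLipschitzHessian γ f) (hγ : 0 ≤ γ)
    (hP : P ∈ covSet d τ ζ) (hmin : ∀ S ∈ covSet d τ ζ, regQ f α μ P ≤ regQ f α μ S) :
    P = frobProj d τ ζ (meanHessian f μ (α ^ 2 • P))⁻¹ :=
  eq_frobProj_inv_of_frobInner_nonneg hτ hτζ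
    (posDef_of_sub_smul_one hσ (h.posSemidef_meanHessian_sub hγ hc)) hP fun _ hS =>
    frobInner_meanHessian_sub_inv_nonneg hτ hτζ hα hL h hγ hP hmin hS

/-- The joint minimizer of the regularized objective is close to the minimizer of `f`. -/
lemma norm_sub_minimizer_le (hσ : 0 < σ) (hτ : 0 < τ) (hτζ : τ ≤ ζ)
    (hL : IsLSmooth L f) (hc : IsStronglyConvex σ f) (h : HasLipschitzHessian γ f) (hγ : 0 ≤ γ)
    (hP : P ∈ covSet d τ ζ) (hmin : ∀ ν, regQ f α μ P ≤ regQ f α ν P)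
    {μstar : EuclideanSpace ℝ (Fin d)} (hμstar : ∀ ν, f μstar ≤ f ν) :
    ‖μstar - μ‖ ≤ γ * (α ^ 2 * (d / τ)) / σ := by
  have hpsd := (posDef_of_mem_covSet (hτ.trans_le hτζ) hP).posSemidef
  have h0 : gradient f μstar = 0 := by
    have : IsLocalMin f μstar := Filter.Eventually.of_forall hμstar
    rw [gradient, this.fderiv_eq_zero, map_zero]
  have h1 := norm_gradient_le_of_isMin (μ := μ) hL h hγ (hpsd.smul (sq_nonneg α)) fun ν => by
    have := hmin ν
    simp only [regQ, gaussJ] at this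
    linarith
  have h2 := hc.mul_norm_le μstar μ
  rw [h0, zero_sub, norm_neg] at h2
  rw [le_div_iff₀ hσ, mul_comm]
  exact h2.trans (h1.trans (mul_le_mul_of_nonneg_left (trace_smul_le_of_mem_covSet hP) hγ))

end Main

end RegularizedES

open RegularizedES in
theorem mainTheorem5 (d : ℕ) (f : EuclideanSpace ℝ (Fin d) → ℝ) (L σ γ τ ζ α : ℝ)
    (hσ : 0 < σ) (hγ : 0 ≤ γ) (hτ : 0 < τ) (hτζ : τ ≤ ζ) (hα : 0 < α)
    (hL : IsLSmooth L f) (hconv : IsStronglyConvex σ f) (hHess : HasLipschitzHessian γ f)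
    (μhat μstar : EuclideanSpace ℝ (Fin d)) (Shat Sstar : Matrix (Fin d) (Fin d) ℝ)
    (hShat : Shat ∈ covSet d τ ζ)
    (hhat : ∀ μ, ∀ S ∈ covSet d τ ζ, regQ f α μhat Shat ≤ regQ f α μ S)
    (hμstar : ∀ μ, f μstar ≤ f μ)
    (hSstar : Sstar ∈ covSet d τ ζ)
    (hstar : ∀ S ∈ covSet d τ ζ, regQ f α μstar Sstar ≤ regQ f α μstar S)
    (hαle : α * (γ * ζ * dimFactor d) ≤ 3 * τ ^ (3 / 2 : ℝ) * σ) :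
    frobNorm (Shat - frobProj d τ ζ (hessian f μhat)⁻¹)
        ≤ α * γ * ζ / (3 * τ ^ (3 / 2 : ℝ) * σ ^ 2) * dimFactor d ∧
      frobNorm (Sstar - Shat)
        ≤ 2 * α * γ * ζ / (3 * τ ^ (3 / 2 : ℝ) * σ ^ 2) * dimFactor d
          + γ / σ ^ 2 *
            Real.sqrt
              (2 * d * L * α ^ 2 / (σ * τ)
                + 2 * γ * α ^ 3 * ((d : ℝ) ^ 2 + 2 * d) ^ (3 / 4 : ℝ) / (3 * σ * τ ^ (3 / 2 : ℝ))
                + d * α ^ 2 / σ * (τ⁻¹ - ζ⁻¹)) := by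
  have hdim := mul_sqrt_le_dimFactor d
  have hd : (d : ℝ) ≤ d * Real.sqrt d := by
    rcases Nat.eq_zero_or_pos d with rfl | hd
    · simp
    · exact le_mul_of_one_le_right (Nat.cast_nonneg d)
        (Real.one_le_sqrt.2 (by exact_mod_cast hd))
  have hζ : 0 < ζ := hτ.trans_le hτζ
  set r := Real.sqrt τ with hr
  have hr0 : 0 < r := Real.sqrt_pos.2 hτ
  have hr2 : r ^ 2 = τ := Real.sq_sqrt hτ.le
  have hr3 : τ ^ (3 / 2 : ℝ) = r ^ 3 := by
    rw [hr, Real.sqrt_eq_rpow, ← Real.rpow_natCast, ← Real.rpow_mul hτ.le]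
    norm_num
  have hpd := fun μ => posDef_of_sub_smul_one hσ (hHess.posSemidef_hessian_sub hconv μ)
  have hmean := fun (μ : EuclideanSpace ℝ (Fin d)) (S : Matrix (Fin d) (Fin d) ℝ) =>
    hHess.posSemidef_meanHessian_sub (μ := μ) (A := α ^ 2 • S) hγ hconv
  have ehat := eq_frobProj_inv_meanHessian hσ hτ hτζ hα hL hconv hHess hγ hShat (hhat μhat)
  have estar := eq_frobProj_inv_meanHessian hσ hτ hτζ hα hL hconv hHess hγ hSstar hstar
  have bhat := frobNorm_meanHessian_sub_hessian_le (μ := μhat) hτ hτζ hα hHess hγ hShat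
  have bstar := frobNorm_meanHessian_sub_hessian_le (μ := μstar) hτ hτζ hα hHess hγ hSstar
  have bμ := norm_sub_minimizer_le hσ hτ hτζ hL hconv hHess hγ hShat
    (fun ν => hhat ν Shat hShat) hμstar
  rw [hr3] at hαle ⊢
  constructor
  · have h1 := frobNorm_frobProj_inv_sub_le hτ hτζ
      (posDef_of_sub_smul_one hσ (hmean μhat Shat)) (hpd μhat)
    rw [← ehat] at h1
    have h2 := (h1.trans (frobNorm_inv_sub_inv_le hσ (hmean μhat Shat)
      (hHess.posSemidef_hessian_sub hconv μhat))).trans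
      (mul_le_mul_of_nonneg_left bhat (by positivity))
    refine h2.trans ?_
    have h3 : 3 * (r ^ 2 * d) ≤ ζ * dimFactor d := by
      calc 3 * (r ^ 2 * d) ≤ r ^ 2 * dimFactor d := by
            rw [hr2]; nlinarith [Nat.cast_nonneg (α := ℝ) d]
        _ ≤ _ := by
            rw [hr2]
            exact mul_le_mul_of_nonneg_right hτζ (by linarith [Nat.cast_nonneg (α := ℝ) d])
    calc (σ ^ 2)⁻¹ * (γ * α * d / r) = γ * α / (3 * r ^ 3 * σ ^ 2) * (3 * (r ^ 2 * d)) := by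
          field_simp
      _ ≤ γ * α / (3 * r ^ 3 * σ ^ 2) * (ζ * dimFactor d) :=
          mul_le_mul_of_nonneg_left h3 (by positivity)
      _ = _ := by ring
  · have h1 := frobNorm_frobProj_inv_sub_le hτ hτζ
      (posDef_of_sub_smul_one hσ (hmean μstar Sstar)) (posDef_of_sub_smul_one hσ (hmean μhat Shat))
    rw [← ehat, ← estar] at h1
    have h2 := h1.trans (frobNorm_inv_sub_inv_le hσ (hmean μstar Sstar) (hmean μhat Shat))
    -- Triangle inequality through the Hessians at the two means; the middle term uses the distance
    -- between the means.
    have h3 : frobNorm (meanHessian f μstar (α ^ 2 • Sstar) - meanHessian f μhat (α ^ 2 • Shat))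
        ≤ γ * α * d / r + (Real.sqrt d * (γ * (γ * (α ^ 2 * (d / τ)) / σ)) + γ * α * d / r) := by
      refine (frobNorm_sub_le _ (hessian f μstar) _).trans (add_le_add bstar ?_)
      refine (frobNorm_sub_le _ (hessian f μhat) _).trans (add_le_add ?_ ?_)
      · refine (hHess.frobNorm_hessian_sub_le hγ _ _).trans ?_
        gcongr
      · rwa [frobNorm_sub_comm]
    -- The square-root term of the claim is nonnegative and is dropped here.
    refine (h2.trans (mul_le_mul_of_nonneg_left h3 (by positivity))).trans
      (le_add_of_le_of_nonneg ?_ (by positivity))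
    set x := Real.sqrt d with hx
    have hx0 : 0 ≤ x := Real.sqrt_nonneg _
    have hd0 : (0 : ℝ) ≤ d := Nat.cast_nonneg d
    -- The restriction on `α`, weakened by `τ ≤ ζ` and `5 d^(3/2) ≤ P_d`, then divided by `r² = τ`.
    have h4 : 5 * (α * γ * (d * x)) ≤ 3 * (r * σ) := by
      have : r ^ 2 * (5 * (α * γ * (d * x))) ≤ r ^ 2 * (3 * (r * σ)) := by
        calc r ^ 2 * (5 * (α * γ * (d * x))) ≤ ζ * (5 * (α * γ * (d * x))) := by
              rw [hr2]; exact mul_le_mul_of_nonneg_right hτζ (by positivity)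
          _ = α * (γ * ζ * (5 * (d * x))) := by ring
          _ ≤ α * (γ * ζ * dimFactor d) := by gcongr
          _ ≤ _ := hαle
          _ = _ := by ring
      exact le_of_mul_le_mul_left this (by positivity)
    -- The second-order term is at most one further copy of the first-order term `d r²`.
    have h5 : α * γ * (d * x) * r / σ ≤ d * r ^ 2 := by
      rcases Nat.eq_zero_or_pos d with h0 | h0
      · simp [h0]
      · have hd1 : (1 : ℝ) ≤ d := by exact_mod_cast h0
        rw [div_le_iff₀ hσ]
        have h6 : α * γ * (d * x) ≤ r * σ := by
          have : 0 < r * σ := by positivity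
          linarith
        calc α * γ * (d * x) * r ≤ r * σ * r := mul_le_mul_of_nonneg_right h6 hr0.le
          _ = 1 * (r ^ 2 * σ) := by ring
          _ ≤ d * (r ^ 2 * σ) := mul_le_mul_of_nonneg_right hd1 (by positivity)
          _ = _ := by ring
    -- The left side is at most `9 d r²`, while the right side is at least `10 d r²`.
    have h6 : 3 * (2 * (d * r ^ 2) + α * γ * (d * x) * r / σ) ≤ 2 * (ζ * dimFactor d) := by
      have h7 : r ^ 2 * (5 * d) ≤ ζ * dimFactor d := by
        rw [hr2]
        exact mul_le_mul hτζ (by linarith) (by positivity) hζ.le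
      have : 0 ≤ r ^ 2 * d := by positivity
      linarith
    calc _ = γ * α / (3 * r ^ 3 * σ ^ 2) * (3 * (2 * (d * r ^ 2) + α * γ * (d * x) * r / σ)) := by
          rw [← hr2]; field_simp; ring
      _ ≤ γ * α / (3 * r ^ 3 * σ ^ 2) * (2 * (ζ * dimFactor d)) :=
          mul_le_mul_of_nonneg_left h6 (by positivity)
      _ = _ := by ring
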